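/- There is a universal constant $c>1$ such that the following holds. Let $q\ge 4$ be a prime power, let $H=\mathrm{SL}(2,q)$ be the group of $2\times 2$ matrices of determinant $1$ over $\mathbb{F}_q$, let $k\ge 1$, $t$ and $b\ge 0$ be integers with $t\ge c^k$, and let $P\colon H^{k\times t}\to\{0,1\}$ be the function computed by a deterministic number-on-forehead protocol with $k$ parties and at most $b$ bits of communication: the input is a matrix $(a_{ij})_{1\le i\le k,\,1\le j\le t}$ over $H$; party $i$ sees all of the input except row $i$; the parties write bits on a shared blackboard, at most $b$ in total on every input, each bit being a function of the bits written before and of what the party writing it sees; and the bits written so far determine who writes next and, at the end, the output. For $g\in H$ let $p_g$ be the probability that $P$ outputs $1$ on an input chosen uniformly among all $(a_{ij})\in H^{k\times t}$ with $\prod_{j=1}^{t}a_{1j}a_{2j}\cdots a_{kj}=g$ (factors in this order). Then for all $g,h\in H$, $$|p_g-p_h|\le 2^{b}\cdot |H|^{-t/c^{k}}.$$ -/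

import Mathlib

/-- A deterministic number-on-forehead communication protocol with `k` parties on inputs
`a : Fin k → Fin t → H` (a `k × t` matrix over `H`), as a protocol tree over a shared blackboard.
At an inner node the party `i` writes one bit, which is a function of all the rows of the input
except row `i`; a leaf carries the output. The bits written so far determine the current node,
hence who speaks next, with which function, and the output. -/
inductive NOFProtocol (H : Type*) (k t : ℕ) where
  | output (o : Fin 2) : NOFProtocol H k t
  | speak (i : Fin k) (msg : ({i' : Fin k // i' ≠ i} → Fin t → H) → Fin 2)
      (next : Fin 2 → NOFProtocol H k t) : NOFProtocol H k t

namespace NOFProtocol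

/-- The output of the protocol on the input `a`. -/
def eval {H : Type*} {k t : ℕ} : NOFProtocol H k t → (Fin k → Fin t → H) → Fin 2
  | output o, _ => o
  | speak _ msg next, a => (next (msg fun i' => a i'.1)).eval a

/-- The number of bits communicated in the worst case: the depth of the protocol tree. -/
def bits {H : Type*} {k t : ℕ} : NOFProtocol H k t → ℕ
  | output _ => 0
  | speak _ _ next => max (next 0).bits (next 1).bits + 1

end NOFProtocol

/-- The interleaved product `∏ j, a 1 j * a 2 j * ⋯ * a k j`, with the factors in this order. -/
def interleavedProd {H : Type*} [Monoid H] {k t : ℕ} (a : Fin k → Fin t → H) : H :=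
  (List.ofFn fun j : Fin t => (List.ofFn fun i : Fin k => a i j).prod).prod

open Classical in
/-- The probability that the protocol `P` outputs `1` on an input chosen uniformly among all the
`k × t` matrices over the finite group `H` whose interleaved product is `g`. -/
noncomputable def acceptProb {H : Type*} [Group H] [Fintype H] {k t : ℕ}
    (P : NOFProtocol H k t) (g : H) : ℝ :=
  ((Finset.univ.filter fun a : Fin k → Fin t → H =>
      interleavedProd a = g ∧ P.eval a = 1).card : ℝ) /
    ((Finset.univ.filter fun a : Fin k → Fin t → H => interleavedProd a = g).card : ℝ)

/-! A protocol tree has at most 2^b leaves, and the inputs reaching a leaf form a cylinder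
intersection (`abs_sum_mul_eval_le`). So it suffices to bound the correlation of f(interleaved
product), where f = |H|(1_g - 1_h), with a product of k bounded functions, each blind to one row.
Repeated Cauchy–Schwarz (`expect_mul_prod_pow_le`) removes these functions and doubles every row,
leaving the mean of the product of f over the 2^k vertices of a cube of inputs.

The 2^k interleaved products on such a cube form a t-step random walk on Γ = H^(2^k), each step
being distributed as `cubeProd`. The tensor power of f has sum zero on Γ, so in the regular
representation its mean along the walk is governed by how far one step contracts the complement of
the fixed vectors (`expect_prod_interleavedProd_sq_le`).

The contraction (`norm_repAvg_cubeProd_sq_le`) holds in every finite-dimensional unitary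
representation, by induction on k. Splitting Γ as G × G, a step is the previous step on the diagonal
of G × G after the projection onto the vectors fixed by the constant pairs from H × H. Off the
vectors fixed by all of G × G, the diagonal-fixed and the constant-fixed vectors are nearly
orthogonal (`norm_constPair_sq_le`). This reduces to the average of the conjugates of constant
families, whose eigenvalues are bounded by normalised character values of H
(`re_inner_diagConjAvg_le`), and these are small on average because SL(2,q) is quasirandom
(`exists_small_matrix_coefficient`). -/

/-! ### Averages of unitary operators over families of group elements. -/

section AverageOverRepresentation

variable {V : Type*} [NormedAddCommGroup V] [InnerProductSpace ℂ V]
variable {G : Type*} [Group G]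

/-- The average of the operators `ρ (s a)` over `a : α`. -/
noncomputable def repAvg {α : Type*} [Fintype α] (ρ : G →* (V ≃ₗᵢ[ℂ] V)) (s : α → G) :
    V →ₗ[ℂ] V :=
  (Fintype.card α : ℂ)⁻¹ • ∑ a, (ρ (s a)).toLinearEquiv.toLinearMap

variable {α β : Type*} [Fintype α] [Fintype β] (ρ : G →* (V ≃ₗᵢ[ℂ] V))

theorem repAvg_apply (s : α → G) (v : V) :
    repAvg ρ s v = (Fintype.card α : ℂ)⁻¹ • ∑ a, ρ (s a) v := by
  simp [repAvg]

theorem rep_mul_apply (g h : G) (v : V) : ρ (g * h) v = ρ g (ρ h v) := by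
  rw [map_mul]; rfl

theorem rep_inner_left (g : G) (v w : V) : inner ℂ (ρ g v) w = inner ℂ v (ρ g⁻¹ w) := by
  rw [← (ρ g⁻¹).inner_map_map, ← rep_mul_apply]; simp

theorem norm_repAvg_le (s : α → G) (v : V) : ‖repAvg ρ s v‖ ≤ ‖v‖ := by
  rw [repAvg_apply, norm_smul]
  have h : ‖∑ a, ρ (s a) v‖ ≤ Fintype.card α * ‖v‖ := by
    refine (norm_sum_le _ _).trans ?_
    simp
  rcases Nat.eq_zero_or_pos (Fintype.card α) with h0 | h0
  · simp [h0]
  · have h0' : (0 : ℝ) < Fintype.card α := by exact_mod_cast h0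
    rw [norm_inv, Complex.norm_natCast, inv_mul_le_iff₀ h0']
    exact h

theorem repAvg_eq_of_forall [Nonempty α] (s : α → G) {v w : V} (h : ∀ a, ρ (s a) v = w) :
    repAvg ρ s v = w := by
  rw [repAvg_apply, Finset.sum_congr rfl fun a _ => h a]
  rw [Finset.sum_const, Finset.card_univ, ← Nat.cast_smul_eq_nsmul ℂ, smul_smul,
    inv_mul_cancel₀ (by exact_mod_cast Fintype.card_ne_zero), one_smul]

theorem rep_repAvg_apply (g : G) (s : α → G) (v : V) :
    ρ g (repAvg ρ s v) = repAvg ρ (fun a => g * s a) v := by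
  simp [repAvg_apply, map_smul, map_sum]

theorem repAvg_rep_apply (g : G) (s : α → G) (v : V) :
    repAvg ρ s (ρ g v) = repAvg ρ (fun a => s a * g) v := by
  simp [repAvg_apply]

theorem repAvg_comp_equiv (e : α ≃ β) (s : β → G) :
    repAvg ρ (fun a => s (e a)) = repAvg ρ s := by
  simp only [repAvg, Fintype.card_congr e]
  congr 1
  exact e.sum_comp fun b => (ρ (s b)).toLinearEquiv.toLinearMap

theorem repAvg_prod (s : α × β → G) (v : V) :
    repAvg ρ s v =
      (Fintype.card α : ℂ)⁻¹ • ∑ a, repAvg ρ (fun b => s (a, b)) v := by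
  simp only [repAvg_apply, Fintype.sum_prod_type, Fintype.card_prod, Nat.cast_mul, mul_inv,
    mul_smul, Finset.smul_sum]

theorem repAvg_mul (s : α → G) (t : β → G) (v : V) :
    repAvg ρ (fun p : α × β => s p.1 * t p.2) v = repAvg ρ s (repAvg ρ t v) := by
  rw [repAvg_prod, repAvg_apply ρ s]
  simp only [rep_repAvg_apply]

theorem inner_repAvg_left (s : α → G) (v w : V) :
    inner ℂ (repAvg ρ s v) w = inner ℂ v (repAvg ρ (fun a => (s a)⁻¹) w) := by
  simp only [repAvg_apply, inner_smul_left, inner_smul_right, sum_inner, inner_sum,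
    rep_inner_left, map_inv₀, Complex.conj_natCast]

variable [Fintype G]

/-- The projection onto the vectors that the group fixes. -/
noncomputable def repProj : V →ₗ[ℂ] V := repAvg ρ (fun g : G => g)

theorem rep_repProj (g : G) (v : V) : ρ g (repProj ρ v) = repProj ρ v := by
  rw [repProj, rep_repAvg_apply]
  exact congrArg (fun T => T v) (repAvg_comp_equiv ρ (Equiv.mulLeft g) fun g => g)

theorem repProj_rep (g : G) (v : V) : repProj ρ (ρ g v) = repProj ρ v := by
  rw [repProj, repAvg_rep_apply]
  exact congrArg (fun T => T v) (repAvg_comp_equiv ρ (Equiv.mulRight g) fun g => g)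

theorem repProj_of_forall {v : V} (h : ∀ g, ρ g v = v) : repProj ρ v = v :=
  repAvg_eq_of_forall ρ _ h

theorem repProj_repProj (v : V) : repProj ρ (repProj ρ v) = repProj ρ v :=
  repProj_of_forall ρ fun g => rep_repProj ρ g v

theorem repAvg_repProj [Nonempty α] (s : α → G) (v : V) :
    repAvg ρ s (repProj ρ v) = repProj ρ v :=
  repAvg_eq_of_forall ρ s fun _ => rep_repProj ρ _ v

theorem repProj_repAvg [Nonempty α] (s : α → G) (v : V) :
    repProj ρ (repAvg ρ s v) = repProj ρ v := by
  rw [repAvg_apply, map_smul, map_sum, Finset.sum_congr rfl fun a _ => repProj_rep ρ (s a) v,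
    Finset.sum_const, Finset.card_univ, ← Nat.cast_smul_eq_nsmul ℂ, smul_smul,
    inv_mul_cancel₀ (by exact_mod_cast Fintype.card_ne_zero), one_smul]

theorem inner_repProj_left (v w : V) :
    inner ℂ (repProj ρ v) w = inner ℂ v (repProj ρ w) := by
  rw [repProj, inner_repAvg_left]
  congr 1
  exact congrArg (fun T => T w) (repAvg_comp_equiv ρ (Equiv.inv G) fun g => g)

theorem norm_repProj_sq (v : V) : ((‖repProj ρ v‖ ^ 2 : ℝ) : ℂ) = inner ℂ v (repProj ρ v) := by
  rw [← repProj_repProj, ← inner_repProj_left, repProj_repProj, inner_self_eq_norm_sq_to_K]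
  simp

theorem norm_sq_eq_repProj (v : V) :
    ‖v‖ ^ 2 = ‖repProj ρ v‖ ^ 2 + ‖v - repProj ρ v‖ ^ 2 := by
  have h : inner ℂ (repProj ρ v) (v - repProj ρ v) = 0 := by
    rw [inner_repProj_left, map_sub, repProj_repProj, sub_self, inner_zero_right]
  have := norm_add_sq_eq_norm_sq_add_norm_sq_of_inner_eq_zero _ _ h
  rw [add_sub_cancel] at this
  nlinarith [this]

theorem repProj_comp_equiv {K : Type*} [Group K] [Fintype K] (e : K ≃* G) :
    repProj (ρ.comp e.toMonoidHom) = repProj ρ :=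
  repAvg_comp_equiv ρ e.toEquiv fun g => g

end AverageOverRepresentation

/-! ### Quasirandomness of SL(2, F). -/

section SpecialLinearGroup

open Matrix

variable {F : Type*} [Field F]

theorem specialLinearGroup_ext {g h : SpecialLinearGroup (Fin 2) F}
    (H : (g : Matrix (Fin 2) (Fin 2) F) = (h : Matrix (Fin 2) (Fin 2) F)) : g = h :=
  Subtype.ext H

theorem specialLinearGroup_coe_mul (g h : SpecialLinearGroup (Fin 2) F) :
    ((g * h : SpecialLinearGroup (Fin 2) F) : Matrix (Fin 2) (Fin 2) F) =
      (g : Matrix (Fin 2) (Fin 2) F) * (h : Matrix (Fin 2) (Fin 2) F) := rfl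

/-- The upper unitriangular matrix with corner `a`. -/
def upperUnip (a : F) : SpecialLinearGroup (Fin 2) F :=
  ⟨!![1, a; 0, 1], by simp [det_fin_two_of]⟩

/-- The diagonal matrix with entries `s` and `s⁻¹`. -/
def diagTorus (s : Fˣ) : SpecialLinearGroup (Fin 2) F :=
  ⟨!![(s : F), 0; 0, ((s⁻¹ : Fˣ) : F)], by simp [det_fin_two_of]⟩

/-- The matrix of the nontrivial Weyl element. -/
def weylElement : SpecialLinearGroup (Fin 2) F :=
  ⟨!![0, -1; 1, 0], by simp [det_fin_two_of]⟩

/-- The lower unitriangular matrix with corner `a`. -/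
def lowerUnip (a : F) : SpecialLinearGroup (Fin 2) F :=
  ⟨!![1, 0; a, 1], by simp [det_fin_two_of]⟩

theorem coe_upperUnip (a : F) : (upperUnip a : Matrix (Fin 2) (Fin 2) F) = !![1, a; 0, 1] := rfl

theorem coe_lowerUnip (a : F) : (lowerUnip a : Matrix (Fin 2) (Fin 2) F) = !![1, 0; a, 1] := rfl

theorem coe_diagTorus (s : Fˣ) : (diagTorus s : Matrix (Fin 2) (Fin 2) F) =
    !![(s : F), 0; 0, ((s⁻¹ : Fˣ) : F)] := rfl

theorem coe_weylElement :
    ((weylElement : SpecialLinearGroup (Fin 2) F) : Matrix (Fin 2) (Fin 2) F) = !![0, -1; 1, 0] :=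
  rfl

theorem upperUnip_add (a b : F) : upperUnip (a + b) = upperUnip a * upperUnip b := by
  apply specialLinearGroup_ext
  rw [specialLinearGroup_coe_mul, coe_upperUnip, coe_upperUnip, coe_upperUnip]
  simp [add_comm]

theorem upperUnip_zero : upperUnip (0 : F) = 1 := by
  apply specialLinearGroup_ext
  exact one_fin_two.symm

theorem upperUnip_mul_diagTorus (a : F) (s : Fˣ) :
    upperUnip a * diagTorus s = diagTorus s * upperUnip (((s⁻¹ : Fˣ) : F) ^ 2 * a) := by
  apply specialLinearGroup_ext
  rw [specialLinearGroup_coe_mul, specialLinearGroup_coe_mul, coe_upperUnip, coe_upperUnip,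
    coe_diagTorus]
  simp
  field_simp

theorem weylElement_conj_upperUnip (a : F) :
    weylElement * upperUnip (-a) * weylElement⁻¹ = lowerUnip a := by
  rw [mul_inv_eq_iff_eq_mul]
  apply specialLinearGroup_ext
  rw [specialLinearGroup_coe_mul, specialLinearGroup_coe_mul, coe_upperUnip, coe_lowerUnip,
    coe_weylElement]
  simp

theorem eq_upperUnip_mul_lowerUnip_mul_upperUnip (g : SpecialLinearGroup (Fin 2) F)
    (hg : g 1 0 ≠ 0) :
    g = upperUnip ((g 0 0 - 1) / g 1 0) * lowerUnip (g 1 0) *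
      upperUnip ((g 1 1 - 1) / g 1 0) := by
  have hdet := g.det_coe
  rw [det_fin_two] at hdet
  apply specialLinearGroup_ext
  rw [specialLinearGroup_coe_mul, specialLinearGroup_coe_mul, coe_upperUnip, coe_lowerUnip,
    coe_upperUnip, eta_fin_two (g : Matrix (Fin 2) (Fin 2) F)]
  simp
  field_simp
  exact ⟨⟨by ring, by linear_combination -hdet⟩, by ring⟩

/-- A subgroup of `SL(2, F)` is everything if it contains the upper unitriangular matrices and is
closed under conjugation by the Weyl element. -/
theorem mem_of_upperUnip_mem (N : Subgroup (SpecialLinearGroup (Fin 2) F))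
    (hU : ∀ a : F, upperUnip a ∈ N)
    (hw : ∀ g ∈ N, weylElement * g * weylElement⁻¹ ∈ N) (g : SpecialLinearGroup (Fin 2) F) :
    g ∈ N := by
  have hL : ∀ a : F, lowerUnip a ∈ N := fun a => by
    rw [← weylElement_conj_upperUnip]
    exact hw _ (hU (-a))
  have key : ∀ g : SpecialLinearGroup (Fin 2) F, g 1 0 ≠ 0 → g ∈ N := fun g hg => by
    rw [eq_upperUnip_mul_lowerUnip_mul_upperUnip g hg]
    exact N.mul_mem (N.mul_mem (hU _) (hL _)) (hU _)
  -- When the lower left entry vanishes, multiplying by `lowerUnip 1` puts `g 1 1` there, which is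
  -- nonzero by the determinant.
  by_cases hg : g 1 0 = 0
  · have hdet := g.det_coe
    rw [det_fin_two] at hdet
    rw [← N.mul_mem_cancel_right (hL 1)]
    refine key _ ?_
    have : ((g * lowerUnip 1 : SpecialLinearGroup (Fin 2) F) :
        Matrix (Fin 2) (Fin 2) F) 1 0 = g 1 1 := by
      rw [specialLinearGroup_coe_mul, coe_lowerUnip]
      simp [Matrix.mul_apply, Fin.sum_univ_two, hg]
    rw [this]
    intro h
    rw [hg, h] at hdet
    simp at hdet
  · exact key g hg

variable [Fintype F] [DecidableEq F]
variable {V : Type*} [NormedAddCommGroup V] [InnerProductSpace ℂ V]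

/-- If only the trivial character of the unipotent group occurred in `W`, that group would lie in
the kernel of the action on `W`; a normal subgroup containing it is everything, so the action would
be trivial. -/
theorem exists_char_eigenvector (ρ : SpecialLinearGroup (Fin 2) F →* (V ≃ₗᵢ[ℂ] V))
    (W : Submodule ℂ V) (hW : ∀ g, ∀ w ∈ W, ρ g w ∈ W)
    (hne : ∃ g, ∃ w ∈ W, ρ g w ≠ w) :
    ∃ ψ : AddChar F ℂ, ψ ≠ 0 ∧ ∃ e ∈ W, ‖e‖ = 1 ∧ ∀ a, ρ (upperUnip a) e = ψ a • e := by
  classical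
  -- Up to the factor |F|, `Q ψ` is the projection onto the ψ-eigenvectors of the unipotent group.
  set Q : AddChar F ℂ → V → V := fun ψ w => ∑ a, ψ (-a) • ρ (upperUnip a) w with hQ
  have hQW : ∀ ψ, ∀ w ∈ W, Q ψ w ∈ W := fun ψ w hw =>
    W.sum_mem fun a _ => W.smul_mem _ (hW _ _ hw)
  have hQe : ∀ ψ w b, ρ (upperUnip b) (Q ψ w) = ψ b • Q ψ w := by
    intro ψ w b
    simp only [hQ, map_sum, map_smul, Finset.smul_sum, smul_smul, ← rep_mul_apply,
      ← upperUnip_add]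
    refine Fintype.sum_equiv (Equiv.addLeft b) _ _ fun a => ?_
    rw [Equiv.coe_addLeft, ← AddChar.map_add_eq_mul]
    congr 2
    ring
  have hsum : ∀ w, ∑ ψ, Q ψ w = (Fintype.card F : ℂ) • w := by
    intro w
    simp only [hQ]
    rw [Finset.sum_comm]
    simp only [← Finset.sum_smul, AddChar.sum_apply_eq_ite, ite_smul, zero_smul, neg_eq_zero]
    simp [upperUnip_zero]
  by_cases hex : ∃ ψ : AddChar F ℂ, ψ ≠ 0 ∧ ∃ w ∈ W, Q ψ w ≠ 0
  · obtain ⟨ψ, hψ, w, hw, hne⟩ := hex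
    refine ⟨ψ, hψ, ((‖Q ψ w‖⁻¹ : ℝ) : ℂ) • Q ψ w, W.smul_mem _ (hQW _ _ hw), ?_, fun a => ?_⟩
    · rw [norm_smul]
      simp [norm_ne_zero_iff.2 hne]
    · rw [map_smul, hQe, smul_comm]
  · push Not at hex
    exfalso
    have hcard : (Fintype.card F : ℂ) ≠ 0 := by exact_mod_cast Fintype.card_ne_zero
    have hfix : ∀ w ∈ W, ∀ a, ρ (upperUnip a) w = w := by
      intro w hw a
      have h1 : Q 0 w = (Fintype.card F : ℂ) • w := by
        rw [← hsum, Finset.sum_eq_single 0 (fun ψ _ hψ => hex ψ hψ w hw) (by simp)]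
      have h2 := hQe 0 w a
      rw [h1, map_smul, AddChar.zero_apply, one_smul] at h2
      exact smul_right_injective V hcard h2
    let N : Subgroup (SpecialLinearGroup (Fin 2) F) :=
      { carrier := {g | ∀ w ∈ W, ρ g w = w}
        one_mem' := by simp
        mul_mem' := fun {a b} ha hb w hw => by rw [rep_mul_apply, hb w hw, ha w hw]
        inv_mem' := fun {a} ha w hw => by
          conv_lhs => rw [← ha w hw]
          rw [← rep_mul_apply]; simp }
    obtain ⟨g, w, hw, hgw⟩ := hne
    refine hgw (mem_of_upperUnip_mem N (fun a w hw => hfix w hw a) ?_ g w hw)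
    intro g hg w hw
    rw [rep_mul_apply, rep_mul_apply, hg _ (hW _ _ hw), ← rep_mul_apply]
    simp

theorem card_units_le_two_mul_card_image_sq :
    Fintype.card F - 1 ≤ 2 * (Finset.univ.image fun s : Fˣ => s ^ 2).card := by
  classical
  rw [← Fintype.card_units, ← Finset.card_univ]
  refine Finset.card_le_mul_card_image _ _ fun b hb => ?_
  obtain ⟨s, -, rfl⟩ := Finset.mem_image.1 hb
  refine (Finset.card_le_card (t := {s, -s}) fun r hr => ?_).trans Finset.card_le_two
  have : r ^ 2 = s ^ 2 := (Finset.mem_filter.1 hr).2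
  have h2 : (r : F) ^ 2 = (s : F) ^ 2 := by exact_mod_cast congrArg Units.val this
  rcases sq_eq_sq_iff_eq_or_eq_neg.1 h2 with h | h
  · simp [Units.ext h]
  · have : r = -s := Units.ext (by simpa using h)
    simp [this]

/-- A lower bound for the dimension of a nontrivial representation of `SL(2, F)`: the number of
nonzero squares of `F`. -/
def numSquares (F : Type*) [Field F] [Fintype F] [DecidableEq F] : ℕ :=
  (Finset.univ.image fun s : Fˣ => s ^ 2).card

/-- The torus carries an eigenvector `e` of the unipotent group to eigenvectors for the characters a
↦ ψ(s⁻²a), distinct for distinct s². These translates are orthonormal and their coefficients against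
the orbit of `e` have the same mean square, so Bessel's inequality gains a factor `numSquares F`. -/
theorem exists_small_matrix_coefficient
    (ρ : SpecialLinearGroup (Fin 2) F →* (V ≃ₗᵢ[ℂ] V))
    (W : Submodule ℂ V) (hW : ∀ g, ∀ w ∈ W, ρ g w ∈ W)
    (hne : ∃ g, ∃ w ∈ W, ρ g w ≠ w) :
    ∃ e ∈ W, ‖e‖ = 1 ∧ (numSquares F : ℝ) * ∑ g, ‖inner ℂ e (ρ g e)‖ ^ 2 ≤
      Fintype.card (SpecialLinearGroup (Fin 2) F) := by
  classical
  obtain ⟨ψ, hψ, e, heW, he1, heig⟩ := exists_char_eigenvector ρ W hW hne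
  refine ⟨e, heW, he1, ?_⟩
  set T := Finset.univ.image fun s : Fˣ => s ^ 2 with hT
  have hsec : ∀ x : T, ∃ s : Fˣ, s ^ 2 = x.1 := fun x => by
    obtain ⟨s, -, hs⟩ := Finset.mem_image.1 x.2
    exact ⟨s, hs⟩
  choose r hr using hsec
  have hact : ∀ (s : Fˣ) (a : F), ρ (upperUnip a) (ρ (diagTorus s) e) =
      ψ (((s⁻¹ : Fˣ) : F) ^ 2 * a) • ρ (diagTorus s) e := by
    intro s a
    rw [← rep_mul_apply, upperUnip_mul_diagTorus, rep_mul_apply, heig, map_smul]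
  have hon : Orthonormal ℂ fun x : T => ρ (diagTorus (r x)) e := by
    refine ⟨fun x => by simp [he1], fun x y hxy => ?_⟩
    set α : F := (((r x)⁻¹ : Fˣ) : F) ^ 2
    set β : F := (((r y)⁻¹ : Fˣ) : F) ^ 2
    have hαβ : α ≠ β := by
      intro h
      apply hxy
      apply Subtype.ext
      rw [← hr x, ← hr y]
      have h' : ((r x)⁻¹) ^ 2 = ((r y)⁻¹) ^ 2 := Units.ext (by simpa [α, β] using h)
      simpa using h'
    obtain ⟨b, hb⟩ := (AddChar.ne_zero_iff (ψ := ψ)).1 hψ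
    -- Chosen so that the two eigenvalues at `a` have ratio `ψ b ≠ 1`; unitarity then forces
    -- orthogonality.
    set a := b / (β - α)
    have hsub : β - α ≠ 0 := sub_ne_zero.2 hαβ.symm
    have hba : β * a = α * a + b := by
      simp only [a]; field_simp; ring
    have hinv := (ρ (upperUnip a)).inner_map_map (ρ (diagTorus (r x)) e) (ρ (diagTorus (r y)) e)
    rw [hact, hact, inner_smul_left, inner_smul_right, hba, AddChar.map_add_eq_mul,
      ← mul_assoc, ← mul_assoc, ← Complex.normSq_eq_conj_mul_self, Complex.normSq_eq_norm_sq,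
      AddChar.norm_apply] at hinv
    have : (ψ b - 1) * inner ℂ (ρ (diagTorus (r x)) e) (ρ (diagTorus (r y)) e) = 0 := by
      rw [sub_mul, sub_eq_zero, one_mul]
      simpa using hinv
    exact (mul_eq_zero.1 this).resolve_left (sub_ne_zero.2 hb)
  have hcoef : ∀ x : T, ∑ g, ‖inner ℂ (ρ (diagTorus (r x)) e) (ρ g e)‖ ^ 2 =
      ∑ g, ‖inner ℂ e (ρ g e)‖ ^ 2 := by
    intro x
    symm
    refine Fintype.sum_equiv (Equiv.mulLeft (diagTorus (r x))) _ _ fun g => ?_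
    rw [Equiv.coe_mulLeft, rep_mul_apply, LinearIsometryEquiv.inner_map_map]
  calc (numSquares F : ℝ) * ∑ g, ‖inner ℂ e (ρ g e)‖ ^ 2
      = ∑ x : T, ∑ g, ‖inner ℂ (ρ (diagTorus (r x)) e) (ρ g e)‖ ^ 2 := by
        rw [Finset.sum_congr rfl fun x _ => hcoef x]
        simp [numSquares, hT]
    _ = ∑ g, ∑ x : T, ‖inner ℂ (ρ (diagTorus (r x)) e) (ρ g e)‖ ^ 2 := Finset.sum_comm
    _ ≤ ∑ g : SpecialLinearGroup (Fin 2) F, (1 : ℝ) := by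
        refine Finset.sum_le_sum fun g _ => ?_
        refine (hon.sum_inner_products_le (ρ g e)).trans ?_
        simp [he1]
    _ = _ := by simp

end SpecialLinearGroup

/-! ### Eigenvalues of the averaged conjugates of constant families. -/

section DiagonalConjugationAverage

variable {V : Type*} [NormedAddCommGroup V] [InnerProductSpace ℂ V]

/-- Schur's lemma for a minimal nonzero invariant subspace: each eigenspace of `T` meets it in an
invariant subspace. One `W` serves all `T`, so that it can be used for every conjugacy class at
once. -/
theorem exists_le_forall_commute_eq_smul [FiniteDimensional ℂ V] {G : Type*} [Group G]
    (ρ : G →* (V ≃ₗᵢ[ℂ] V)) (S : Submodule ℂ V) (hS : ∀ g, ∀ w ∈ S, ρ g w ∈ S) (hS0 : S ≠ ⊥) :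
    ∃ W ≤ S, W ≠ ⊥ ∧ (∀ g, ∀ w ∈ W, ρ g w ∈ W) ∧
      ∀ T : V →ₗ[ℂ] V, (∀ g v, T (ρ g v) = ρ g (T v)) → (∀ w ∈ W, T w ∈ W) →
        ∃ c : ℂ, ∀ w ∈ W, T w = c • w := by
  obtain ⟨W, ⟨hWS, hW0, hW⟩, hmin⟩ := WellFounded.has_min
    (wellFounded_lt (α := Submodule ℂ V))
    {W | W ≤ S ∧ W ≠ ⊥ ∧ ∀ g, ∀ w ∈ W, ρ g w ∈ W} ⟨S, le_rfl, hS0, hS⟩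
  refine ⟨W, hWS, hW0, hW, fun T hTρ hTW => ?_⟩
  have : Nontrivial W := Submodule.nontrivial_iff_ne_bot.2 hW0
  obtain ⟨c, hc⟩ := Module.End.exists_eigenvalue (T.restrict hTW)
  obtain ⟨v, hv⟩ := hc.exists_hasEigenvector
  have hv1 : T v.1 = c • v.1 := by
    have := congrArg Subtype.val hv.apply_eq_smul
    simpa using this
  have hv0 : v.1 ≠ 0 := fun h => hv.2 (Subtype.ext h)
  refine ⟨c, ?_⟩
  have hle : W ≤ Module.End.eigenspace T c := by
    by_contra hcon
    refine hmin (W ⊓ Module.End.eigenspace T c) ⟨inf_le_left.trans hWS, ?_, ?_⟩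
      (inf_le_left.lt_of_ne fun h => hcon (inf_eq_left.1 h))
    · intro h
      have : v.1 ∈ W ⊓ Module.End.eigenspace T c :=
        ⟨v.2, Module.End.mem_eigenspace_iff.2 hv1⟩
      rw [h] at this
      exact hv0 ((Submodule.mem_bot ℂ).1 this)
    · rintro g w ⟨hw, hw'⟩
      refine ⟨hW g w hw, Module.End.mem_eigenspace_iff.2 ?_⟩
      rw [hTρ, Module.End.mem_eigenspace_iff.1 hw', map_smul]
  exact fun w hw => Module.End.mem_eigenspace_iff.1 (hle hw)

theorem rep_eq_self_of_mulSingle {ι H : Type*} [Finite ι] [DecidableEq ι] [Group H]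
    (ρ : (ι → H) →* (V ≃ₗᵢ[ℂ] V)) (w : V)
    (h : ∀ i (a : H), ρ (Pi.mulSingle i a) w = w) (g : ι → H) : ρ g w = w := by
  let N : Subgroup (ι → H) :=
    { carrier := {g | ρ g w = w}
      one_mem' := by simp
      mul_mem' := fun {a b} ha hb => by
        change ρ (a * b) w = w
        rw [rep_mul_apply, hb, ha]
      inv_mem' := fun {a} ha => by
        change ρ a⁻¹ w = w
        conv_lhs => rw [← show ρ a w = w from ha]
        rw [← rep_mul_apply]; simp }
  exact Subgroup.pi_mem_of_mulSingle_mem (H := N) g fun i => h i (g i)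

variable {H : Type*} [Group H] [Fintype H]

/-- Every nontrivial unitary action of `H` on a subspace of `V` has a unit vector whose matrix
coefficient has mean square at most `x ^ 2`. -/
def HasSmallCoefficients (H V : Type*) [Group H] [Fintype H] [NormedAddCommGroup V]
    [InnerProductSpace ℂ V] (x : ℝ) : Prop :=
  ∀ (ρ : H →* (V ≃ₗᵢ[ℂ] V)) (W : Submodule ℂ V), (∀ g, ∀ w ∈ W, ρ g w ∈ W) →
    (∃ g, ∃ w ∈ W, ρ g w ≠ w) →
      ∃ e ∈ W, ‖e‖ = 1 ∧ ∑ g, ‖inner ℂ e (ρ g e)‖ ^ 2 ≤ x ^ 2 * Fintype.card H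

/-- Pairing with `e` shows that `c h` is the mean of the matrix coefficient of `e` over the
conjugates of `h`. Hence the L¹ norm of `c` is at most that of the coefficient, and Cauchy–Schwarz
applies. -/
theorem sum_norm_class_scalar_le {x : ℝ} (hx : 0 ≤ x) (hH : HasSmallCoefficients H V x)
    (ρ : H →* (V ≃ₗᵢ[ℂ] V)) (W : Submodule ℂ V) (hW : ∀ g, ∀ w ∈ W, ρ g w ∈ W)
    (hne : ∃ g, ∃ w ∈ W, ρ g w ≠ w) (c : H → ℂ)
    (hc : ∀ h, ∀ w ∈ W, repAvg ρ (fun y => y * h * y⁻¹) w = c h • w) :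
    ∑ h, ‖c h‖ ≤ x * Fintype.card H := by
  obtain ⟨e, heW, he1, hsum⟩ := hH ρ W hW hne
  have hcard : (0 : ℝ) < Fintype.card H := by exact_mod_cast Fintype.card_pos
  have hval : ∀ h, c h = (Fintype.card H : ℂ)⁻¹ * ∑ y, inner ℂ e (ρ (y * h * y⁻¹) e) := by
    intro h
    have := congrArg (inner ℂ e) (hc h e heW)
    rw [repAvg_apply, inner_smul_right, inner_sum, inner_smul_right,
      inner_self_eq_norm_sq_to_K, he1] at this
    simpa using this.symm
  have hle : ∀ h, ‖c h‖ ≤ (Fintype.card H : ℝ)⁻¹ * ∑ y, ‖inner ℂ e (ρ (y * h * y⁻¹) e)‖ := by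
    intro h
    rw [hval, norm_mul, norm_inv, Complex.norm_natCast]
    gcongr
    exact norm_sum_le _ _
  have hL1 : ∑ h, ‖c h‖ ≤ ∑ h, ‖inner ℂ e (ρ h e)‖ := by
    calc ∑ h, ‖c h‖ ≤ ∑ h, (Fintype.card H : ℝ)⁻¹ * ∑ y, ‖inner ℂ e (ρ (y * h * y⁻¹) e)‖ :=
          Finset.sum_le_sum fun h _ => hle h
      _ = (Fintype.card H : ℝ)⁻¹ * ∑ y : H, ∑ h, ‖inner ℂ e (ρ (y * h * y⁻¹) e)‖ := by
          rw [← Finset.mul_sum, Finset.sum_comm]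
      _ = (Fintype.card H : ℝ)⁻¹ * ∑ _y : H, ∑ h, ‖inner ℂ e (ρ h e)‖ := by
          congr 1
          refine Finset.sum_congr rfl fun y _ => ?_
          exact Fintype.sum_equiv (MulAut.conj y).toEquiv _ _ fun h => rfl
      _ = _ := by
          rw [Finset.sum_const, Finset.card_univ, nsmul_eq_mul, inv_mul_cancel_left₀ hcard.ne']
  refine hL1.trans (le_of_sq_le_sq ?_ (by positivity))
  calc (∑ h, ‖inner ℂ e (ρ h e)‖) ^ 2
      ≤ Fintype.card H * ∑ h, ‖inner ℂ e (ρ h e)‖ ^ 2 := by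
        rw [← Finset.card_univ]; exact sq_sum_le_card_mul_sum_sq
    _ ≤ Fintype.card H * (x ^ 2 * Fintype.card H) := by gcongr
    _ = (x * Fintype.card H) ^ 2 := by ring

theorem rep_mulSingle_conj_apply {ι : Type*} [DecidableEq ι] (ρ : (ι → H) →* (V ≃ₗᵢ[ℂ] V))
    (i : ι) (g : ι → H) (v : V) :
    repAvg ρ (fun y : H => Pi.mulSingle i y * g * (Pi.mulSingle i y)⁻¹) v =
      repAvg (ρ.comp (MonoidHom.mulSingle (fun _ => H) i)) (fun y => y * g i * y⁻¹)
        (ρ (Function.update g i 1) v) := by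
  simp only [repAvg_apply, MonoidHom.comp_apply, MonoidHom.mulSingle_apply, ← rep_mul_apply]
  congr 1
  refine Finset.sum_congr rfl fun y _ => ?_
  congr 2
  ext j
  rcases eq_or_ne j i with rfl | hj
  · simp
  · simp [hj]

variable {ι : Type*} [Fintype ι] [DecidableEq ι]

/-- The average of the conjugates of the constant families. -/
noncomputable def diagConjAvg (ρ : (ι → H) →* (V ≃ₗᵢ[ℂ] V)) : V →ₗ[ℂ] V :=
  repAvg ρ fun p : H × (ι → H) => p.2 * (fun _ => p.1) * p.2⁻¹

theorem diagConjAvg_rep (ρ : (ι → H) →* (V ≃ₗᵢ[ℂ] V)) (g : ι → H) (v : V) :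
    diagConjAvg ρ (ρ g v) = ρ g (diagConjAvg ρ v) := by
  rw [diagConjAvg, repAvg_rep_apply, rep_repAvg_apply,
    ← repAvg_comp_equiv ρ ((Equiv.refl H).prodCongr (Equiv.mulLeft g))]
  congr 2
  ext p : 1
  simp [mul_assoc]

theorem diagConjAvg_isSymmetric (ρ : (ι → H) →* (V ≃ₗᵢ[ℂ] V)) :
    (diagConjAvg ρ).IsSymmetric := by
  intro v w
  change inner ℂ (diagConjAvg ρ v) w = inner ℂ v (diagConjAvg ρ w)
  rw [diagConjAvg, inner_repAvg_left,
    ← repAvg_comp_equiv ρ ((Equiv.inv H).prodCongr (Equiv.refl (ι → H)))]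
  congr 3
  ext p : 1
  ext j
  simp [mul_assoc]

/-- An extra conjugation in coordinate `i` does not change the average. It turns coordinate `i` into
the scalar `c`, evaluated at a uniform element of `H`, while the other coordinates act
isometrically; the triangle inequality leaves the mean of ‖c‖. -/
theorem norm_le_of_diagConjAvg_eq_smul {x : ℝ} (hx : 0 ≤ x) (hH : HasSmallCoefficients H V x)
    (ρ : (ι → H) →* (V ≃ₗᵢ[ℂ] V)) (W : Submodule ℂ V) (hW : ∀ g, ∀ w ∈ W, ρ g w ∈ W)
    (i : ι) (hne : ∃ h : H, ∃ w ∈ W, ρ (Pi.mulSingle i h) w ≠ w) (c : H → ℂ)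
    (hc : ∀ h, ∀ w ∈ W, repAvg (ρ.comp (MonoidHom.mulSingle (fun _ => H) i))
      (fun y => y * h * y⁻¹) w = c h • w)
    {w : V} (hw : w ∈ W) (hw0 : w ≠ 0) {μ : ℂ} (hμ : diagConjAvg ρ w = μ • w) : ‖μ‖ ≤ x := by
  have hcard : (0 : ℝ) < Fintype.card H := by exact_mod_cast Fintype.card_pos
  have hcard' : (0 : ℝ) < Fintype.card (ι → H) := by exact_mod_cast Fintype.card_pos
  have hsum := sum_norm_class_scalar_le hx hH (ρ.comp (MonoidHom.mulSingle (fun _ => H) i)) W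
    (fun g => hW _) hne c hc
  set s : H × (ι → H) → (ι → H) := fun p => p.2 * (fun _ => p.1) * p.2⁻¹ with hs
  have h1 : diagConjAvg ρ w = repAvg ρ
      (fun p : H × (H × (ι → H)) => Pi.mulSingle i p.1 * s p.2 * (Pi.mulSingle i p.1)⁻¹) w := by
    rw [repAvg_prod]
    have : ∀ y : H, repAvg ρ (fun b => Pi.mulSingle i y * s b * (Pi.mulSingle i y)⁻¹) w =
        diagConjAvg ρ w := by
      intro y
      rw [← repAvg_rep_apply, ← rep_repAvg_apply]
      change ρ _ (diagConjAvg ρ _) = _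
      rw [diagConjAvg_rep, ← rep_mul_apply]
      simp
    rw [Finset.sum_congr rfl fun y _ => this y, Finset.sum_const, Finset.card_univ,
      ← Nat.cast_smul_eq_nsmul ℂ, smul_smul,
      inv_mul_cancel₀ (by exact_mod_cast Fintype.card_ne_zero), one_smul]
  have h2 : diagConjAvg ρ w = (Fintype.card (H × (ι → H)) : ℂ)⁻¹ •
      ∑ p, c (s p i) • ρ (Function.update (s p) i 1) w := by
    rw [h1, ← repAvg_comp_equiv ρ (Equiv.prodComm _ _), repAvg_prod]
    congr 1
    refine Finset.sum_congr rfl fun p _ => ?_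
    rw [← hc _ _ (hW _ _ hw), ← rep_mulSingle_conj_apply]
    rfl
  have h3 : ∑ p, ‖c (s p i)‖ ≤ x * Fintype.card (H × (ι → H)) := by
    rw [Fintype.sum_prod_type_right]
    have : ∀ g : ι → H, ∑ h, ‖c (s (h, g) i)‖ = ∑ h, ‖c h‖ := fun g =>
      Fintype.sum_equiv (MulAut.conj (g i)).toEquiv _ _ fun h => rfl
    rw [Finset.sum_congr rfl fun g _ => this g, Finset.sum_const, Finset.card_univ, nsmul_eq_mul,
      Fintype.card_prod, Nat.cast_mul]
    nlinarith
  have hw0' : 0 < ‖w‖ := norm_pos_iff.2 hw0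
  have h4 : ‖μ‖ * ‖w‖ ≤ x * ‖w‖ := by
    rw [← norm_smul, ← hμ, h2, norm_smul, norm_inv, Complex.norm_natCast,
      inv_mul_le_iff₀ (by exact_mod_cast Fintype.card_pos)]
    refine (norm_sum_le _ _).trans ?_
    simp only [norm_smul, LinearIsometryEquiv.norm_map]
    rw [← Finset.sum_mul]
    nlinarith
  exact le_of_mul_le_mul_right h4 hw0'

/-- In an orthonormal eigenbasis, any eigenvector with eigenvalue above `x` is fixed by the whole
group, hence orthogonal to `u`. Otherwise a minimal invariant subspace of non-fixed eigenvectors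
would have some coordinate acting nontrivially, against the previous bound. -/
theorem re_inner_diagConjAvg_le [FiniteDimensional ℂ V] {x : ℝ} (hx : 0 ≤ x)
    (hH : HasSmallCoefficients H V x)
    (ρ : (ι → H) →* (V ≃ₗᵢ[ℂ] V)) {u : V} (hu : repProj ρ u = 0) :
    (inner ℂ u (diagConjAvg ρ u)).re ≤ x * ‖u‖ ^ 2 := by
  have hsymm := diagConjAvg_isSymmetric ρ
  set b := hsymm.eigenvectorBasis rfl
  set μ := hsymm.eigenvalues rfl
  have hb : ∀ i, diagConjAvg ρ (b i) = (μ i : ℂ) • b i := hsymm.apply_eigenvectorBasis rfl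
  have hkey : ∀ (ν : ℝ) (e : V), diagConjAvg ρ e = (ν : ℂ) • e → x < ν → repProj ρ e = e := by
    intro ν e he hν
    by_contra hne
    have hPC : ∀ v, repProj ρ (diagConjAvg ρ v) = diagConjAvg ρ (repProj ρ v) := fun v => by
      rw [diagConjAvg, repProj_repAvg, repAvg_repProj]
    set S := Module.End.eigenspace (diagConjAvg ρ) (ν : ℂ) ⊓ LinearMap.ker (repProj ρ)
    have hS0 : S ≠ ⊥ := by
      intro hbot
      have : e - repProj ρ e ∈ S := by
        refine ⟨Module.End.mem_eigenspace_iff.2 ?_, ?_⟩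
        · rw [map_sub, ← hPC, he, map_smul, smul_sub]
        · change repProj ρ (e - repProj ρ e) = 0
          rw [map_sub, repProj_repProj, sub_self]
      rw [hbot, Submodule.mem_bot, sub_eq_zero] at this
      exact hne this.symm
    have hS : ∀ g, ∀ w ∈ S, ρ g w ∈ S := by
      rintro g w ⟨hw, hw'⟩
      refine ⟨Module.End.mem_eigenspace_iff.2 ?_, ?_⟩
      · rw [diagConjAvg_rep, Module.End.mem_eigenspace_iff.1 hw, map_smul]
      · change repProj ρ (ρ g w) = 0
        rw [repProj_rep]; exact hw'
    obtain ⟨W, hWS, hW0, hW, hsch⟩ := exists_le_forall_commute_eq_smul ρ S hS hS0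
    obtain ⟨w, hw, hw0⟩ := W.exists_mem_ne_zero_of_ne_bot hW0
    by_cases htriv : ∃ i, ∃ h : H, ∃ w ∈ W, ρ (Pi.mulSingle i h) w ≠ w
    · obtain ⟨i, hi⟩ := htriv
      have hex : ∀ h : H, ∃ c : ℂ, ∀ w ∈ W,
          repAvg (ρ.comp (MonoidHom.mulSingle (fun _ => H) i)) (fun y => y * h * y⁻¹) w =
            c • w := by
        intro h
        refine hsch _ (fun g v => ?_) fun w hw => ?_
        · have hconj : repAvg ρ (fun y : H => Pi.mulSingle i y * Pi.mulSingle i h *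
              (Pi.mulSingle i y)⁻¹) = repAvg (ρ.comp (MonoidHom.mulSingle (fun _ => H) i))
                (fun y => y * h * y⁻¹) := by
            ext v
            rw [rep_mulSingle_conj_apply]
            simp [Pi.mulSingle]
          rw [← hconj, repAvg_rep_apply, rep_repAvg_apply,
            ← repAvg_comp_equiv ρ (Equiv.mulLeft (g i))]
          congr 2
          ext y j
          rcases eq_or_ne j i with rfl | hj
          · simp [mul_assoc]
          · simp [hj]
        · rw [repAvg_apply]
          exact W.smul_mem _ (W.sum_mem fun y _ => hW _ _ hw)
      choose c hc using hex
      have := norm_le_of_diagConjAvg_eq_smul hx hH ρ W hW i hi c hc hw hw0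
        (Module.End.mem_eigenspace_iff.1 (hWS hw).1)
      rw [Complex.norm_real] at this
      exact absurd (hν.trans_le ((le_abs_self ν).trans this)) (lt_irrefl _)
    · push Not at htriv
      refine hw0 ?_
      rw [← repProj_of_forall ρ (rep_eq_self_of_mulSingle ρ w fun i a => htriv i a w hw)]
      exact (hWS hw).2
  have hexp : inner ℂ u (diagConjAvg ρ u) = ∑ i, ((μ i * ‖inner ℂ (b i) u‖ ^ 2 : ℝ) : ℂ) := by
    rw [← b.sum_inner_mul_inner]
    refine Finset.sum_congr rfl fun i _ => ?_
    rw [← hsymm (b i) u, hb, inner_smul_left, ← inner_conj_symm u (b i)]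
    push_cast
    rw [Complex.conj_ofReal, ← Complex.conj_mul']
    ring
  rw [hexp, ← Complex.ofReal_sum, Complex.ofReal_re, ← b.sum_sq_norm_inner_right u, Finset.mul_sum]
  refine Finset.sum_le_sum fun i _ => ?_
  rcases le_or_gt (μ i) x with h | h
  · gcongr
  · have : inner ℂ (b i) u = 0 := by
      rw [← hkey _ _ (hb i) h, inner_repProj_left, hu, inner_zero_right]
    simp [this]

end DiagonalConjugationAverage

/-! ### Contraction of one step of the walk on H^(2^k). -/

section CubeAverage

variable {V : Type*} [NormedAddCommGroup V] [InnerProductSpace ℂ V]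
variable {H : Type*} [Group H] [Fintype H]

/-- The pairs of constant families, as a homomorphism. -/
def constPairHom (ι H : Type*) [Group H] : H × H →* (ι → H) × (ι → H) where
  toFun z := (fun _ => z.1, fun _ => z.2)
  map_one' := rfl
  map_mul' _ _ := rfl

/-- The diagonal embedding of a group in its square. -/
def diagHom (G : Type*) [Group G] : G →* G × G := (MonoidHom.id G).prod (MonoidHom.id G)

theorem repProj_comp_hom {G K : Type*} [Group G] [Group K] [Fintype K]
    (ρ : G →* (V ≃ₗᵢ[ℂ] V)) (φ : K →* G) : repProj (ρ.comp φ) = repAvg ρ φ := rfl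

theorem repProj_repProj_comp {G K : Type*} [Group G] [Fintype G] [Group K] [Fintype K]
    (ρ : G →* (V ≃ₗᵢ[ℂ] V)) (φ : K →* G) (v : V) :
    repProj ρ (repProj (ρ.comp φ) v) = repProj ρ v := by
  rw [repProj_comp_hom, repProj_repAvg]

theorem rep_eq_of_diag {G : Type*} [Group G] (ρ : G × G →* (V ≃ₗᵢ[ℂ] V)) {u : V}
    (hu : ∀ g, ρ (g, g) u = u) (a b : G) : ρ (a, b) u = ρ (a * b⁻¹, 1) u := by
  conv_rhs => rw [← hu b, ← rep_mul_apply]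
  simp

theorem rep_conj_of_diag {G : Type*} [Group G] (ρ : G × G →* (V ≃ₗᵢ[ℂ] V)) {u : V}
    (hu : ∀ g, ρ (g, g) u = u) (a g : G) : ρ (g * a * g⁻¹, 1) u = ρ (g, g) (ρ (a, 1) u) := by
  rw [← rep_mul_apply, Prod.mk_mul_mk, rep_eq_of_diag ρ hu (g * a)]
  simp

/-- The average of `u` over the first factor is still fixed by the diagonal; together the two
subgroups generate G × G, so it equals the full projection of `u`. -/
theorem repProj_inl_eq_zero {G : Type*} [Group G] [Fintype G] (ρ : G × G →* (V ≃ₗᵢ[ℂ] V)) {u : V}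
    (hu : ∀ g, ρ (g, g) u = u) (hP : repProj ρ u = 0) :
    repProj (ρ.comp (MonoidHom.inl G G)) u = 0 := by
  set y := repProj (ρ.comp (MonoidHom.inl G G)) u with hy
  have h1 : ∀ a, ρ (a, 1) y = y := fun a => rep_repProj (ρ.comp (MonoidHom.inl G G)) a u
  have h2 : ∀ g, ρ (g, g) y = y := by
    intro g
    rw [hy, repProj_comp_hom, repAvg_apply, map_smul, map_sum]
    congr 1
    refine Fintype.sum_equiv (MulAut.conj g).toEquiv _ _ fun a => ?_
    exact (rep_conj_of_diag ρ hu a g).symm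
  have h3 : repProj ρ y = y := repProj_of_forall ρ fun g => by
    rw [← Prod.mk.eta (p := g), rep_eq_of_diag ρ h2, h1]
  rw [← h3, hy, repProj_comp_hom, repProj_repAvg, hP]

/-- On a diagonal-fixed `u`, the pair (a, b) acts as (ab⁻¹, 1), so only constants in the first
factor remain. Their quadratic form at `u` is unchanged by conjugation in G, which turns it into
that of `diagConjAvg`. -/
theorem norm_constPair_sq_le {ι : Type*} [Fintype ι] [DecidableEq ι] [FiniteDimensional ℂ V]
    {x : ℝ} (hx : 0 ≤ x) (hH : HasSmallCoefficients H V x)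
    (ρ : (ι → H) × (ι → H) →* (V ≃ₗᵢ[ℂ] V)) {u : V}
    (hu : ∀ g, ρ (g, g) u = u) (hP : repProj ρ u = 0) :
    ‖repProj (ρ.comp (constPairHom ι H)) u‖ ^ 2 ≤ x * ‖u‖ ^ 2 := by
  set ρ₁ := ρ.comp (MonoidHom.inl (ι → H) (ι → H)) with hρ₁
  have h1 : repProj (ρ.comp (constPairHom ι H)) u = repAvg ρ₁ (fun h : H => fun _ : ι => h) u := by
    rw [repProj_comp_hom, ← repAvg_comp_equiv ρ (Equiv.prodComm H H), repAvg_prod]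
    have : ∀ b : H, repAvg ρ (fun a => constPairHom ι H ((Equiv.prodComm H H) (b, a))) u =
        repAvg ρ₁ (fun h : H => fun _ : ι => h) u := by
      intro b
      rw [← repAvg_comp_equiv ρ₁ (Equiv.mulRight b⁻¹), repAvg_apply, repAvg_apply]
      congr 1
      exact Finset.sum_congr rfl fun a _ => rep_eq_of_diag ρ hu (fun _ => a) (fun _ => b)
    rw [Finset.sum_congr rfl fun b _ => this b, Finset.sum_const, Finset.card_univ,
      ← Nat.cast_smul_eq_nsmul ℂ, smul_smul,
      inv_mul_cancel₀ (by exact_mod_cast Fintype.card_ne_zero), one_smul]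
  have h2 : inner ℂ u (diagConjAvg ρ₁ u) =
      inner ℂ u (repAvg ρ₁ (fun h : H => fun _ : ι => h) u) := by
    rw [diagConjAvg, repAvg_apply, repAvg_apply, inner_smul_right, inner_smul_right, inner_sum,
      inner_sum, Fintype.sum_prod_type_right]
    have : ∀ g : ι → H, ∑ h : H, inner ℂ u (ρ₁ (g * (fun _ => h) * g⁻¹) u) =
        ∑ h : H, inner ℂ u (ρ₁ (fun _ => h) u) := fun g =>
      Finset.sum_congr rfl fun h _ => by
        change inner ℂ u (ρ (g * (fun _ => h) * g⁻¹, 1) u) = inner ℂ u (ρ (fun _ => h, 1) u)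
        rw [rep_conj_of_diag ρ hu]
        conv_lhs => rw [← hu g]
        rw [LinearIsometryEquiv.inner_map_map, hu]
    rw [Finset.sum_congr rfl fun g _ => this g, Finset.sum_const, Finset.card_univ, nsmul_eq_mul,
      Fintype.card_prod, Nat.cast_mul, mul_inv, mul_assoc, inv_mul_cancel_left₀]
    exact_mod_cast Fintype.card_ne_zero
  have h3 := re_inner_diagConjAvg_le hx hH ρ₁ (repProj_inl_eq_zero ρ hu hP)
  rw [h2, ← h1, ← norm_repProj_sq, Complex.ofReal_re] at h3
  exact h3

/-- The family of the products `y 0 (ε 0) * ⋯ * y (k - 1) (ε (k - 1))`. -/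
def cubeProd {k : ℕ} (y : Fin k → Bool → H) (ε : Fin k → Bool) : H :=
  (List.ofFn fun i => y i (ε i)).prod

/-- Splitting a cube along its last direction. -/
def cubeSplit (k : ℕ) (H : Type*) [Group H] :
    ((Fin k → Bool) → H) × ((Fin k → Bool) → H) ≃* ((Fin (k + 1) → Bool) → H) where
  toFun p ε := if ε (Fin.last k) then p.2 (fun i => ε i.castSucc) else p.1 fun i => ε i.castSucc
  invFun g := (fun ε => g (Fin.snoc ε false), fun ε => g (Fin.snoc ε true))
  left_inv p := by ext ε <;> simp
  right_inv g := by
    ext ε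
    have h : (Fin.snoc (fun i => ε (Fin.castSucc i)) (ε (Fin.last k)) : Fin (k + 1) → Bool) = ε :=
      Fin.snoc_init_self ε
    cases hε : ε (Fin.last k) <;> rw [hε] at h <;> simp [hε, h]
  map_mul' p q := by
    ext ε
    simp only [Pi.mul_apply, Prod.fst_mul, Prod.snd_mul]
    split_ifs <;> rfl

/-- The last factor of the product depends only on the last bit, so it is constant on each half of
the cube; the earlier factors agree on both halves. -/
theorem repAvg_cubeProd_succ {k : ℕ} (ρ : ((Fin (k + 1) → Bool) → H) →* (V ≃ₗᵢ[ℂ] V)) (v : V) :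
    repAvg ρ cubeProd v =
      repAvg ((ρ.comp (cubeSplit k H).toMonoidHom).comp (diagHom _)) cubeProd
        (repProj ((ρ.comp (cubeSplit k H).toMonoidHom).comp (constPairHom _ H)) v) := by
  let e : (Fin k → Bool → H) × (H × H) ≃ (Fin (k + 1) → Bool → H) :=
    (((Equiv.refl (Fin k → Bool → H)).prodCongr (Equiv.boolArrowEquivProd H).symm).trans
      (Equiv.prodComm _ _)).trans (Fin.snocEquiv fun _ => Bool → H)
  rw [← repAvg_comp_equiv ρ e]
  change _ = repAvg ρ (fun y : Fin k → Bool → H => cubeSplit k H (cubeProd y, cubeProd y))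
    (repAvg ρ (fun z : H × H => cubeSplit k H (fun _ => z.1, fun _ => z.2)) v)
  rw [← repAvg_mul]
  congr 2
  ext p ε
  simp only [Pi.mul_apply, cubeSplit, MulEquiv.coe_mk, Equiv.coe_fn_mk, ite_self]
  simp only [cubeProd, List.ofFn_succ', List.concat_eq_append, List.prod_append,
    List.prod_singleton, e]
  cases hε : ε (Fin.last k) <;> simp [Equiv.boolArrowEquivProd, Fin.snocEquiv]

theorem repAvg_cubeProd_one (ρ : ((Fin 1 → Bool) → H) →* (V ≃ₗᵢ[ℂ] V)) :
    repAvg ρ cubeProd = repProj ρ := by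
  let e : (Fin 1 → Bool → H) ≃ ((Fin 1 → Bool) → H) :=
    (Equiv.funUnique (Fin 1) (Bool → H)).trans
      ((Equiv.funUnique (Fin 1) Bool).symm.arrowCongr (Equiv.refl H))
  rw [repProj, ← repAvg_comp_equiv ρ e]
  congr 1
  ext y ε
  simp [cubeProd, e]

theorem add_mul_one_sub_le_eighth_root {x r : ℝ} (hr0 : 0 ≤ r) (hx : x ≤ 3 / 4)
    (hxr : x ≤ r ^ 8) (hr1 : r ≤ 1) : x * (1 - r ^ 8) + r ^ 8 ≤ r := by
  -- Use `x ≤ 3/4` above the threshold 6/7 = 8 · (3/4) / 7, and `x ≤ r ^ 8` below it. The claim then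
  -- reduces to 1 - 8r⁷ + 7r⁸ ≥ 0, which has the double root 1.
  have h8 : 8 * x ≤ 7 * r := by
    rcases le_or_gt (6 / 7) r with h | h
    · linarith
    · have : r ^ 7 ≤ (6 / 7) ^ 7 := pow_le_pow_left₀ hr0 h.le 7
      have h2 : r ^ 8 = r ^ 7 * r := by ring
      have h3 : r ^ 7 * r ≤ (6 / 7) ^ 7 * r := by gcongr
      have h4 : ((6 : ℝ) / 7) ^ 7 ≤ 7 / 8 := by norm_num
      nlinarith
  have hr8 : r ^ 8 ≤ 1 := pow_le_one₀ hr0 hr1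
  have h1 : x * (1 - r ^ 8) ≤ 7 / 8 * r * (1 - r ^ 8) := by
    apply mul_le_mul_of_nonneg_right <;> linarith
  have h2 : 0 ≤ r * ((1 - r) ^ 2 *
      (1 + 2 * r + 3 * r ^ 2 + 4 * r ^ 3 + 5 * r ^ 4 + 6 * r ^ 5 + 7 * r ^ 6)) := by positivity
  nlinarith [h1, h2]

/-- After the constant-pair projection `w` of `v`, the diagonal-fixed part `u` satisfies ‖u‖² ≤
x‖w‖² and is kept by the step; the rest contracts by induction. An eighth root per dimension absorbs
the resulting recursion. -/
theorem norm_repAvg_cubeProd_sq_le [FiniteDimensional ℂ V] {x : ℝ} (hx0 : 0 < x)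
    (hx : x ≤ 3 / 4) (hH : HasSmallCoefficients H V x) (k : ℕ)
    (ρ : ((Fin (k + 1) → Bool) → H) →* (V ≃ₗᵢ[ℂ] V)) (v : V) (hv : repProj ρ v = 0) :
    ‖repAvg ρ cubeProd v‖ ^ 2 ≤ x ^ ((1 / 8 : ℝ) ^ k) * ‖v‖ ^ 2 := by
  induction k generalizing v with
  | zero =>
    rw [repAvg_cubeProd_one, hv]
    simp only [norm_zero, ne_eq, OfNat.ofNat_ne_zero, not_false_eq_true, zero_pow]
    positivity
  | succ k ih =>
    rw [repAvg_cubeProd_succ]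
    set ρ' := ρ.comp (cubeSplit (k + 1) H).toMonoidHom
    set w := repProj (ρ'.comp (constPairHom _ H)) v with hw
    set ρd := ρ'.comp (diagHom _)
    set u := repProj ρd w with hu
    have hPw : repProj ρ' w = 0 := by
      rw [hw, repProj_repProj_comp, repProj_comp_equiv, hv]
    have hPu : repProj ρ' u = 0 := by
      rw [hu, repProj_repProj_comp, hPw]
    have hfix : ∀ g, ρ' (g, g) u = u := fun g => rep_repProj ρd g w
    have hwv : ‖w‖ ≤ ‖v‖ := norm_repAvg_le _ _ v
    have hθ := norm_constPair_sq_le hx0.le hH ρ' hfix hPu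
    set q := repProj (ρ'.comp (constPairHom _ H)) u
    -- Both projections are self-adjoint and `w` is fixed by the second, so ‖u‖² = ⟨u, w⟩ = ⟨q, w⟩.
    have hqu : ‖u‖ ^ 2 ≤ ‖q‖ * ‖w‖ := by
      have h1 : ((‖u‖ ^ 2 : ℝ) : ℂ) = inner ℂ q w := by
        have hqw : inner ℂ q w = inner ℂ u w := by
          rw [inner_repProj_left, hw, repProj_repProj]
        rw [hqw, hu, norm_repProj_sq ρd w, inner_repProj_left ρd w w]
      have h2 := norm_inner_le_norm (𝕜 := ℂ) q w
      rw [← h1, Complex.norm_real, Real.norm_of_nonneg (by positivity)] at h2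
      exact h2
    have huw : ‖u‖ ^ 2 ≤ x * ‖w‖ ^ 2 := by
      rcases (sq_nonneg ‖u‖).eq_or_lt with h0 | h0
      · rw [← h0]; positivity
      · have : ‖u‖ ^ 2 * ‖u‖ ^ 2 ≤ (x * ‖w‖ ^ 2) * ‖u‖ ^ 2 := by
          calc ‖u‖ ^ 2 * ‖u‖ ^ 2 ≤ (‖q‖ * ‖w‖) * (‖q‖ * ‖w‖) := by gcongr
            _ = ‖q‖ ^ 2 * ‖w‖ ^ 2 := by ring
            _ ≤ (x * ‖u‖ ^ 2) * ‖w‖ ^ 2 := by gcongr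
            _ = _ := by ring
        exact le_of_mul_le_mul_right this h0
    have hsplit := norm_sq_eq_repProj ρd w
    have hsplit' := norm_sq_eq_repProj ρd (repAvg ρd cubeProd w)
    have hAu : repAvg ρd cubeProd u = u := repAvg_repProj ρd _ w
    rw [repProj_repAvg] at hsplit'
    rw [← hu] at hsplit hsplit'
    have hih := ih ρd (w - u) (by rw [map_sub, hu, repProj_repProj, sub_self])
    rw [map_sub, hAu] at hih
    set r := x ^ ((1 / 8 : ℝ) ^ (k + 1)) with hr
    have hr8 : x ^ ((1 / 8 : ℝ) ^ k) = r ^ 8 := by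
      rw [hr, ← Real.rpow_mul_natCast hx0.le]
      congr 1
      rw [pow_succ]; push_cast; ring
    have hr0 : 0 ≤ r := by positivity
    have hx1 : x ≤ 1 := by linarith
    have hr1 : r ≤ 1 := Real.rpow_le_one hx0.le hx1 (by positivity)
    have hxr : x ≤ r ^ 8 := by
      rw [← hr8]
      calc x = x ^ (1 : ℝ) := (Real.rpow_one x).symm
        _ ≤ _ := Real.rpow_le_rpow_of_exponent_ge hx0 hx1
          (pow_le_one₀ (by norm_num) (by norm_num))
    rw [hr8] at hih
    have hrec := add_mul_one_sub_le_eighth_root hr0 hx hxr hr1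
    have hr81 : r ^ 8 ≤ 1 := pow_le_one₀ hr0 hr1
    calc ‖repAvg ρd cubeProd w‖ ^ 2 ≤ ‖u‖ ^ 2 + r ^ 8 * ‖w - u‖ ^ 2 := by linarith
      _ = ‖u‖ ^ 2 * (1 - r ^ 8) + r ^ 8 * ‖w‖ ^ 2 := by rw [hsplit]; ring
      _ ≤ x * ‖w‖ ^ 2 * (1 - r ^ 8) + r ^ 8 * ‖w‖ ^ 2 := by
        gcongr
      _ = (x * (1 - r ^ 8) + r ^ 8) * ‖w‖ ^ 2 := by ring
      _ ≤ r * ‖v‖ ^ 2 := by gcongr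

end CubeAverage

/-! ### Cylinder intersections and the box norm. -/

section BoxNorm

open Finset
open scoped BigOperators

theorem expect_pow_two_pow_le {α : Type*} [Fintype α] [Nonempty α] (z : α → ℝ) (k : ℕ) :
    (𝔼 a, z a) ^ 2 ^ k ≤ 𝔼 a, z a ^ 2 ^ k := by
  induction k generalizing z with
  | zero => simp
  | succ k ih =>
    have h2 : (𝔼 a, z a) ^ 2 ≤ 𝔼 a, z a ^ 2 := by
      rw [Fintype.expect_eq_sum_div_card, Fintype.expect_eq_sum_div_card, div_pow]
      have hc : (0 : ℝ) < Fintype.card α := by exact_mod_cast Fintype.card_pos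
      have := sq_sum_le_card_mul_sum_sq (s := univ) (f := z)
      rw [card_univ] at this
      rw [div_le_div_iff₀ (by positivity) hc]
      nlinarith
    calc (𝔼 a, z a) ^ 2 ^ (k + 1) = ((𝔼 a, z a) ^ 2) ^ 2 ^ k := by rw [← pow_mul, pow_succ']
      _ ≤ (𝔼 a, z a ^ 2) ^ 2 ^ k := by gcongr
      _ ≤ 𝔼 a, (z a ^ 2) ^ 2 ^ k := ih _
      _ = _ := by simp only [← pow_mul, pow_succ' 2 k]

variable {X : Type*} [Fintype X] [Nonempty X]

theorem expect_fin_cons {M : Type*} [AddCommMonoid M] [Module ℚ≥0 M] {k : ℕ} {Y : Type*}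
    [Fintype Y] (f : (Fin (k + 1) → Y) → M) :
    𝔼 a, f a = 𝔼 y : Fin k → Y, 𝔼 x, f (Fin.cons x y) := by
  rw [← Fintype.expect_equiv (Fin.consEquiv fun _ : Fin (k + 1) => Y)
    (fun p => f (Fin.cons p.1 p.2)) f fun p => rfl]
  rw [← univ_product_univ, expect_product, expect_comm]

/-- The Cauchy–Schwarz inequality for cylinder intersections. -/
theorem expect_mul_prod_pow_le (k : ℕ) (f : (Fin k → X) → ℝ) (φ : Fin k → (Fin k → X) → ℝ)
    (hφ : ∀ i a, |φ i a| ≤ 1) (hi : ∀ i a x, φ i (Function.update a i x) = φ i a) :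
    (𝔼 a, f a * ∏ i, φ i a) ^ 2 ^ k ≤
      𝔼 x : Fin k → Bool → X, ∏ ε : Fin k → Bool, f fun i => x i (ε i) := by
  induction k with
  | zero =>
    simp only [pow_zero, pow_one, univ_unique, expect_singleton, prod_singleton, univ_eq_empty,
      prod_empty, mul_one]
    exact le_of_eq (congrArg f (Subsingleton.elim _ _))
  | succ k ih =>
    set x₀ : X := Classical.arbitrary X
    set B : (Fin k → X) → X → ℝ := fun y x =>
      f (Fin.cons x y) * ∏ i : Fin k, φ i.succ (Fin.cons x y) with hB
    -- `φ 0` ignores coordinate 0, so that coordinate may be frozen at `x₀` and `φ 0` pulled out of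
    -- the inner mean, where Cauchy–Schwarz discards it.
    have hsplit : 𝔼 a, f a * ∏ i, φ i a =
        𝔼 y : Fin k → X, φ 0 (Fin.cons x₀ y) * 𝔼 x, B y x := by
      rw [expect_fin_cons]
      refine expect_congr rfl fun y _ => ?_
      rw [mul_expect]
      refine expect_congr rfl fun x _ => ?_
      have h0 : φ 0 (Fin.cons x y) = φ 0 (Fin.cons x₀ y) := by
        rw [← hi 0 _ x₀, Fin.update_cons_zero]
      rw [Fin.prod_univ_succ, h0, hB]
      ring
    have hsq : (𝔼 a, f a * ∏ i, φ i a) ^ 2 ≤ 𝔼 p : Bool → X, 𝔼 y : Fin k → X,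
        (∏ b, f (Fin.cons (p b) y)) * ∏ i : Fin k, ∏ b, φ i.succ (Fin.cons (p b) y) := by
      calc (𝔼 a, f a * ∏ i, φ i a) ^ 2 ≤ 𝔼 y, (φ 0 (Fin.cons x₀ y) * 𝔼 x, B y x) ^ 2 := by
            rw [hsplit]
            simpa using expect_pow_two_pow_le
              (fun y : Fin k → X => φ 0 (Fin.cons x₀ y) * 𝔼 x, B y x) 1
        _ ≤ 𝔼 y, (𝔼 x, B y x) ^ 2 := by
            refine expect_le_expect fun y _ => ?_
            rw [mul_pow]
            have := (sq_le_one_iff_abs_le_one _).2 (hφ 0 (Fin.cons x₀ y))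
            nlinarith [sq_nonneg (𝔼 x, B y x)]
        _ = 𝔼 y, 𝔼 p : Bool → X, ∏ b, B y (p b) := by
            refine expect_congr rfl fun y _ => ?_
            rw [sq, expect_mul_expect, ← expect_product', univ_product_univ]
            exact (Fintype.expect_equiv (Equiv.boolArrowEquivProd X) _ _ fun p => by
              simp [Equiv.boolArrowEquivProd, mul_comm]).symm
        _ = _ := by
            rw [expect_comm]
            refine expect_congr rfl fun p _ => expect_congr rfl fun y _ => ?_
            rw [hB, prod_mul_distrib, prod_comm (s := univ (α := Fin k))]
    have hstep : ∀ p : Bool → X, (𝔼 y : Fin k → X,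
        (∏ b, f (Fin.cons (p b) y)) * ∏ i : Fin k, ∏ b, φ i.succ (Fin.cons (p b) y)) ^ 2 ^ k ≤
        𝔼 x : Fin k → Bool → X, ∏ ε : Fin k → Bool,
          ∏ b, f (Fin.cons (p b) fun i => x i (ε i)) := by
      intro p
      refine ih (fun y => ∏ b, f (Fin.cons (p b) y))
        (fun i y => ∏ b, φ i.succ (Fin.cons (p b) y)) (fun i y => ?_) fun i y x => ?_
      · rw [abs_prod]
        exact prod_le_one (fun _ _ => abs_nonneg _) fun _ _ => hφ _ _
      · refine prod_congr rfl fun b _ => ?_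
        rw [Fin.cons_update, hi]
    calc (𝔼 a, f a * ∏ i, φ i a) ^ 2 ^ (k + 1)
        = ((𝔼 a, f a * ∏ i, φ i a) ^ 2) ^ 2 ^ k := by rw [← pow_mul, pow_succ']
      _ ≤ _ := pow_le_pow_left₀ (sq_nonneg _) hsq _
      _ ≤ _ := expect_pow_two_pow_le _ _
      _ ≤ _ := expect_le_expect fun p _ => hstep p
      _ = _ := by
        rw [expect_fin_cons, expect_comm]
        refine expect_congr rfl fun x _ => expect_congr rfl fun p _ => ?_
        rw [← (Fintype.prod_equiv (Fin.consEquiv fun _ : Fin (k + 1) => Bool)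
          (fun q => f fun i => (Fin.cons p x : Fin (k + 1) → Bool → X) i
            ((Fin.cons q.1 q.2 : Fin (k + 1) → Bool) i)) _ fun q => rfl),
          Fintype.prod_prod_type_right]
        refine prod_congr rfl fun ε _ => prod_congr rfl fun b _ => congrArg f ?_
        ext i
        refine Fin.cases ?_ (fun j => ?_) i <;> simp

variable {H : Type*} {k t : ℕ}

/-- Induction on the tree: the indicator of the bit that party `j` writes ignores row `j`, so it is
absorbed into `φ j`. This is why `φ` is arbitrary; each bit doubles the number of terms. -/
theorem abs_sum_mul_eval_le [Fintype H] (f : (Fin k → Fin t → H) → ℝ) {B : ℝ}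
    (hf : ∀ φ : Fin k → (Fin k → Fin t → H) → ℝ, (∀ i a, |φ i a| ≤ 1) →
      (∀ i a x, φ i (Function.update a i x) = φ i a) → |𝔼 a, f a * ∏ i, φ i a| ≤ B)
    (P : NOFProtocol H k t) (φ : Fin k → (Fin k → Fin t → H) → ℝ) (hφ : ∀ i a, |φ i a| ≤ 1)
    (hi : ∀ i a x, φ i (Function.update a i x) = φ i a) :
    |𝔼 a, f a * (∏ i, φ i a) * (if P.eval a = 1 then 1 else 0)| ≤ 2 ^ P.bits * B := by
  have hB : 0 ≤ B := (abs_nonneg _).trans (hf φ hφ hi)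
  induction P generalizing φ with
  | output o =>
    by_cases ho : o = 1
    · simpa [NOFProtocol.eval, NOFProtocol.bits, ho] using hf φ hφ hi
    · simpa [NOFProtocol.eval, NOFProtocol.bits, ho] using hB
  | speak j msg next ih =>
    set m : (Fin k → Fin t → H) → Fin 2 := fun a => msg fun i' => a i'.1 with hm
    have hmj : ∀ a x, m (Function.update a j x) = m a := by
      intro a x
      simp only [hm]
      congr 1
      ext i' : 1
      exact Function.update_of_ne i'.2 x a
    set χ : Fin 2 → Fin k → (Fin k → Fin t → H) → ℝ := fun o i a =>
      if i = j then φ i a * (if m a = o then 1 else 0) else φ i a with hχ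
    have hχ1 : ∀ o i a, |χ o i a| ≤ 1 := by
      intro o i a
      simp only [hχ]
      split_ifs <;> simp [hφ]
    have hχi : ∀ o i a x, χ o i (Function.update a i x) = χ o i a := by
      intro o i a x
      simp only [hχ]
      split_ifs with h1 h2 h3 h3
      · rw [hi]
      · subst h1; exact absurd (by rw [← h2, hmj]) h3
      · subst h1; exact absurd (by rw [hmj, h3]) h2
      · simp
      · rw [hi]
    have hprod : ∀ o a, ∏ i, χ o i a = (∏ i, φ i a) * (if m a = o then 1 else 0) := by
      intro o a
      rw [← mul_prod_erase univ _ (mem_univ j), ← mul_prod_erase univ (fun i => φ i a) (mem_univ j)]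
      rw [prod_congr rfl fun i hi' => show χ o i a = φ i a by simp [hχ, ne_of_mem_erase hi']]
      simp only [hχ, if_true]
      ring
    have hsplit : 𝔼 a, f a * (∏ i, φ i a) *
          (if (NOFProtocol.speak j msg next).eval a = 1 then 1 else 0) =
        ∑ o, 𝔼 a, f a * (∏ i, χ o i a) * (if (next o).eval a = 1 then 1 else 0) := by
      rw [← expect_sum_comm]
      refine expect_congr rfl fun a _ => ?_
      have heval : (NOFProtocol.speak j msg next).eval a = (next (m a)).eval a := rfl
      rw [heval, sum_eq_single (m a)]
      · rw [hprod]; simp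
      · intro o _ ho
        rw [hprod]; simp [ho.symm]
      · simp
    rw [hsplit]
    have hbit : ∀ o, (next o).bits + 1 ≤ (NOFProtocol.speak j msg next).bits := by
      intro o
      simp only [NOFProtocol.bits]
      fin_cases o <;> simp
    calc |∑ o, 𝔼 a, f a * (∏ i, χ o i a) * (if (next o).eval a = 1 then 1 else 0)|
        ≤ ∑ o, |𝔼 a, f a * (∏ i, χ o i a) * (if (next o).eval a = 1 then 1 else 0)| :=
          abs_sum_le_sum_abs _ _
      _ ≤ ∑ o, (2 : ℝ) ^ (next o).bits * B :=
          sum_le_sum fun o _ => ih o (χ o) (hχ1 o) (hχi o)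
      _ ≤ ∑ _o : Fin 2, (2 : ℝ) ^ ((NOFProtocol.speak j msg next).bits - 1) * B := by
          gcongr with o
          · norm_num
          · have := hbit o; omega
      _ = _ := by
          rw [sum_const, card_univ, Fintype.card_fin, nsmul_eq_mul, ← mul_assoc, Nat.cast_two,
            ← pow_succ']
          congr 2

end BoxNorm

/-! ### The regular representation. -/

section RegularRepresentation

/-- The left regular representation. -/
noncomputable def regularRep (G : Type*) [Group G] [Fintype G] :
    G →* (EuclideanSpace ℂ G ≃ₗᵢ[ℂ] EuclideanSpace ℂ G) where
  toFun g := LinearIsometryEquiv.piLpCongrLeft 2 ℂ ℂ (Equiv.mulLeft g)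
  map_one' := by ext v x; simp [-Equiv.mulLeft_one]
  map_mul' g h := by ext v x; simp [Equiv.Perm.mul_def]

variable {G : Type*} [Group G] [Fintype G] [DecidableEq G]

theorem regularRep_single (g x : G) :
    regularRep G g (EuclideanSpace.single x 1) = EuclideanSpace.single (g * x) 1 := by
  ext y
  simp [regularRep]

theorem inner_regularRep_single_one (f : G → ℝ) (g : G) :
    inner ℂ (WithLp.toLp 2 fun x => (f x : ℂ) : EuclideanSpace ℂ G)
      (regularRep G g (EuclideanSpace.single 1 1)) = f g := by
  rw [regularRep_single, mul_one, EuclideanSpace.inner_single_right]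
  simp

end RegularRepresentation

/-! ### Contraction over t independent steps. -/

section Iterate

variable {V : Type*} [NormedAddCommGroup V] [InnerProductSpace ℂ V]
variable {G : Type*} [Group G] [Fintype G] {α : Type*} [Fintype α] [Nonempty α]

theorem norm_repAvg_prod_ofFn_sq_le (ρ : G →* (V ≃ₗᵢ[ℂ] V)) (s : α → G) {L : ℝ} (hL : 0 ≤ L)
    (h : ∀ v, repProj ρ v = 0 → ‖repAvg ρ s v‖ ^ 2 ≤ L * ‖v‖ ^ 2) (t : ℕ) (v : V)
    (hv : repProj ρ v = 0) :
    ‖repAvg ρ (fun y : Fin t → α => (List.ofFn fun j => s (y j)).prod) v‖ ^ 2 ≤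
      L ^ t * ‖v‖ ^ 2 := by
  induction t with
  | zero =>
    rw [pow_zero, one_mul]
    exact pow_le_pow_left₀ (norm_nonneg _) (norm_repAvg_le _ _ _) 2
  | succ t ih =>
    have : repAvg ρ (fun y : Fin (t + 1) → α => (List.ofFn fun j => s (y j)).prod) v =
        repAvg ρ s (repAvg ρ (fun y : Fin t → α => (List.ofFn fun j => s (y j)).prod) v) := by
      rw [← repAvg_mul, ← repAvg_comp_equiv ρ (Fin.consEquiv fun _ : Fin (t + 1) => α)]
      congr 2
      ext p
      simp [List.ofFn_succ, Fin.consEquiv]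
    rw [this]
    calc _ ≤ L * _ := h _ (by rw [repProj_repAvg, hv])
      _ ≤ L * (L ^ t * ‖v‖ ^ 2) := by gcongr
      _ = _ := by ring

end Iterate

/-! ### From the spectral gap to acceptance probabilities. -/

section InterleavedProduct

open Finset
open scoped BigOperators

variable {H : Type*} [Group H]

theorem interleavedProd_mulSingle_mul {k t : ℕ} (z : H) (a : Fin (k + 1) → Fin (t + 1) → H) :
    interleavedProd (Pi.mulSingle 0 (Pi.mulSingle 0 z) * a) = z * interleavedProd a := by
  simp [interleavedProd, List.ofFn_succ, Pi.mulSingle_apply, mul_assoc]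

theorem prod_ofFn_cubeProd_apply {k t : ℕ} (y : Fin t → Fin k → Bool → H) (ε : Fin k → Bool) :
    (List.ofFn fun j => cubeProd (y j)).prod ε = interleavedProd fun i j => y j i (ε i) := by
  rw [Pi.list_prod_apply, List.map_ofFn]
  rfl

variable [Fintype H]

/-- Columns are independent, so the mean is the pairing of the tensor power of `f` with the t-step
average of the point mass at 1. The tensor power sums to zero, so the fixed part of the point mass
drops out. -/
theorem expect_prod_interleavedProd_sq_le [DecidableEq H] {x : ℝ} (hx0 : 0 < x) (hx : x ≤ 3 / 4)
    {k : ℕ}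
    (hH : HasSmallCoefficients H (EuclideanSpace ℂ ((Fin (k + 1) → Bool) → H)) x)
    (t : ℕ) (f : H → ℝ) (hf : ∑ h, f h = 0) :
    (𝔼 a : Fin (k + 1) → Bool → Fin t → H,
      ∏ ε : Fin (k + 1) → Bool, f (interleavedProd fun i => a i (ε i))) ^ 2 ≤
      (∑ h, f h ^ 2) ^ 2 ^ (k + 1) * (x ^ ((1 / 8 : ℝ) ^ k)) ^ t := by
  set Γ := (Fin (k + 1) → Bool) → H
  set ρ := regularRep Γ
  set F : Γ → ℝ := fun γ => ∏ ε, f (γ ε) with hF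
  set Φ : EuclideanSpace ℂ Γ := WithLp.toLp 2 fun γ => (F γ : ℂ) with hΦ
  set δ : EuclideanSpace ℂ Γ := EuclideanSpace.single 1 1 with hδ
  set s : (Fin t → Fin (k + 1) → Bool → H) → Γ :=
    fun y => (List.ofFn fun j => cubeProd (y j)).prod with hs
  have hinner : ∀ γ, inner ℂ Φ (ρ γ δ) = F γ := inner_regularRep_single_one F
  have hsum0 : ∑ γ, F γ = 0 := by
    rw [hF, ← Fintype.piFinset_univ, ← prod_univ_sum]
    simp [hf]
  have hproj : inner ℂ Φ (repProj ρ δ) = 0 := by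
    rw [repProj, repAvg_apply, inner_smul_right, inner_sum, sum_congr rfl fun γ _ => hinner γ,
      ← Complex.ofReal_sum, hsum0]
    simp
  have hexp : ((𝔼 a : Fin (k + 1) → Bool → Fin t → H,
      ∏ ε : Fin (k + 1) → Bool, f (interleavedProd fun i => a i (ε i)) : ℝ) : ℂ) =
      inner ℂ Φ (repAvg ρ s δ) := by
    let e : (Fin (k + 1) → Bool → Fin t → H) ≃ (Fin t → Fin (k + 1) → Bool → H) :=
      { toFun := fun a j i b => a i b j
        invFun := fun y i b j => y j i b
        left_inv := fun _ => rfl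
        right_inv := fun _ => rfl }
    rw [repAvg_apply, inner_smul_right, inner_sum, sum_congr rfl fun y _ => hinner (s y),
      ← Complex.ofReal_sum, Fintype.expect_equiv e _ (fun y => F (s y)) fun a => ?_,
      Fintype.expect_eq_sum_div_card, div_eq_inv_mul]
    · push_cast
      rfl
    · simp only [hF, hs, prod_ofFn_cubeProd_apply]
      rfl
  have hcenter : inner ℂ Φ (repAvg ρ s δ) = inner ℂ Φ (repAvg ρ s (δ - repProj ρ δ)) := by
    rw [map_sub, inner_sub_right, repAvg_repProj, hproj, sub_zero]
  have hΦn : ‖Φ‖ ^ 2 = (∑ h, f h ^ 2) ^ 2 ^ (k + 1) := by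
    rw [EuclideanSpace.norm_sq_eq]
    have : ∀ γ, ‖Φ γ‖ ^ 2 = ∏ ε, f (γ ε) ^ 2 := fun γ => by
      simp [hΦ, hF, prod_pow, ← abs_prod]
    rw [sum_congr rfl fun γ _ => this γ, ← Fintype.piFinset_univ,
      ← prod_univ_sum (fun _ => univ) fun _ h => f h ^ 2]
    simp
  have hδn : ‖δ - repProj ρ δ‖ ^ 2 ≤ 1 := by
    have := norm_sq_eq_repProj ρ δ
    have h1 : ‖δ‖ = 1 := by simp [hδ]
    rw [h1] at this
    nlinarith [sq_nonneg ‖repProj ρ δ‖]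
  have hdecay := norm_repAvg_prod_ofFn_sq_le ρ cubeProd (by positivity)
    (norm_repAvg_cubeProd_sq_le hx0 hx hH k ρ) t (δ - repProj ρ δ)
    (by rw [map_sub, repProj_repProj, sub_self])
  have hCS := norm_inner_le_norm (𝕜 := ℂ) Φ (repAvg ρ s (δ - repProj ρ δ))
  rw [← hcenter, ← hexp, Complex.norm_real, Real.norm_eq_abs] at hCS
  rw [← sq_abs]
  calc _ ≤ (‖Φ‖ * ‖repAvg ρ s (δ - repProj ρ δ)‖) ^ 2 := pow_le_pow_left₀ (abs_nonneg _) hCS 2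
    _ = ‖Φ‖ ^ 2 * ‖repAvg ρ s (δ - repProj ρ δ)‖ ^ 2 := mul_pow _ _ _
    _ ≤ ‖Φ‖ ^ 2 * ((x ^ ((1 / 8 : ℝ) ^ k)) ^ t * ‖δ - repProj ρ δ‖ ^ 2) := by gcongr
    _ ≤ ‖Φ‖ ^ 2 * ((x ^ ((1 / 8 : ℝ) ^ k)) ^ t * 1) := by gcongr
    _ = _ := by rw [hΦn, mul_one]

/-- Left multiplication of the very first entry permutes the fibres, so they all have the same size.
-/
theorem card_fiber_interleavedProd [DecidableEq H] {k t : ℕ} (g : H) :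
    (Fintype.card H : ℝ) * #{a : Fin (k + 1) → Fin (t + 1) → H | interleavedProd a = g} =
      Fintype.card (Fin (k + 1) → Fin (t + 1) → H) := by
  have hconst : ∀ h : H, #{a : Fin (k + 1) → Fin (t + 1) → H | interleavedProd a = g} =
      #{a : Fin (k + 1) → Fin (t + 1) → H | interleavedProd a = h} := by
    intro h
    rw [card_filter, card_filter]
    refine Fintype.sum_equiv
      (Equiv.mulLeft (Pi.mulSingle 0 (Pi.mulSingle 0 (h * g⁻¹)))) _ _ fun a => ?_
    rw [Equiv.coe_mulLeft, interleavedProd_mulSingle_mul]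
    congr 1
    rw [mul_assoc, eq_iff_iff]
    constructor
    · rintro rfl; simp
    · intro h'
      have : g⁻¹ * interleavedProd a = 1 := by simpa using h'
      exact (inv_mul_eq_one.1 this).symm
  have hsum := card_eq_sum_card_fiberwise (s := univ) (t := univ)
    (f := fun a : Fin (k + 1) → Fin (t + 1) → H => interleavedProd a) (by simp)
  rw [sum_congr rfl fun h _ => (hconst h).symm, sum_const, card_univ, card_univ,
    smul_eq_mul] at hsum
  exact_mod_cast hsum.symm

theorem acceptProb_eq_expect [DecidableEq H] {k t : ℕ} (P : NOFProtocol H (k + 1) (t + 1)) (g : H) :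
    acceptProb P g = 𝔼 a, (Fintype.card H * if interleavedProd a = g then (1 : ℝ) else 0) *
      (if P.eval a = 1 then 1 else 0) := by
  have hfib := card_fiber_interleavedProd (k := k) (t := t) g
  have hH : (Fintype.card H : ℝ) ≠ 0 := by exact_mod_cast Fintype.card_ne_zero
  have hX : (Fintype.card (Fin (k + 1) → Fin (t + 1) → H) : ℝ) ≠ 0 := by
    exact_mod_cast Fintype.card_ne_zero
  have hN : (#{a : Fin (k + 1) → Fin (t + 1) → H | interleavedProd a = g} : ℝ) ≠ 0 :=
    fun h => hX (by rw [← hfib, h, mul_zero])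
  have hnum : ∑ a, (Fintype.card H * if interleavedProd a = g then (1 : ℝ) else 0) *
      (if P.eval a = 1 then 1 else 0) = Fintype.card H *
        #{a : Fin (k + 1) → Fin (t + 1) → H | interleavedProd a = g ∧ P.eval a = 1} := by
    rw [card_filter, Nat.cast_sum, mul_sum]
    refine sum_congr rfl fun a _ => ?_
    by_cases h1 : interleavedProd a = g <;> by_cases h2 : P.eval a = 1 <;> simp [h1, h2]
  rw [Fintype.expect_eq_sum_div_card, hnum, ← hfib, mul_div_mul_left _ _ hH, acceptProb]
  congr!

/-- `hle` compares powers: 2^(k+1) comes from repeated Cauchy–Schwarz over k+1 rows, and the outer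
square from the spectral bound. -/
theorem abs_acceptProb_sub_le [DecidableEq H] {x : ℝ} (hx0 : 0 < x) (hx : x ≤ 3 / 4) {k t : ℕ}
    (hH : HasSmallCoefficients H (EuclideanSpace ℂ ((Fin (k + 1) → Bool) → H)) x)
    (P : NOFProtocol H (k + 1) (t + 1)) (g h : H) {B : ℝ} (hB : 0 ≤ B)
    (hle : ((Fintype.card H : ℝ) ^ 3) ^ 2 ^ (k + 1) * (x ^ ((1 / 8 : ℝ) ^ k)) ^ (t + 1) ≤
      (B ^ 2 ^ (k + 1)) ^ 2) :
    |acceptProb P g - acceptProb P h| ≤ 2 ^ P.bits * B := by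
  set f : H → ℝ := fun z => Fintype.card H * (if z = g then (1 : ℝ) else 0) -
    Fintype.card H * (if z = h then 1 else 0) with hf
  have hf0 : ∑ z, f z = 0 := by
    simp [hf, sum_sub_distrib]
  have hf2 : ∑ z, f z ^ 2 ≤ (Fintype.card H : ℝ) ^ 3 := by
    have : ∀ z, f z ^ 2 ≤ (Fintype.card H : ℝ) ^ 2 := by
      intro z
      simp only [hf]
      split_ifs <;> simp
    calc ∑ z, f z ^ 2 ≤ ∑ _z : H, (Fintype.card H : ℝ) ^ 2 := sum_le_sum fun z _ => this z
      _ = _ := by rw [sum_const, card_univ, nsmul_eq_mul]; ring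
  have hdiff : acceptProb P g - acceptProb P h =
      𝔼 a, f (interleavedProd a) * (∏ _i : Fin (k + 1), (1 : ℝ)) *
        (if P.eval a = 1 then 1 else 0) := by
    rw [acceptProb_eq_expect, acceptProb_eq_expect, ← expect_sub_distrib]
    refine expect_congr rfl fun a _ => ?_
    rw [prod_const_one, hf]
    ring
  rw [hdiff]
  refine abs_sum_mul_eval_le (fun a => f (interleavedProd a)) ?_ P (fun _ _ => 1) (by simp)
    (by simp)
  intro φ hφ hi
  have hbox := expect_mul_prod_pow_le (k + 1) (fun a => f (interleavedProd a)) φ hφ hi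
  have hspec := expect_prod_interleavedProd_sq_le hx0 hx hH (t + 1) f hf0
  set E := 𝔼 a, f (interleavedProd a) * ∏ i, φ i a
  have heven : Even (2 ^ (k + 1)) := (even_two).pow_of_ne_zero (Nat.succ_ne_zero k)
  have h1 : (|E| ^ 2 ^ (k + 1)) ^ 2 ≤ (B ^ 2 ^ (k + 1)) ^ 2 := by
    rw [heven.pow_abs]
    refine (pow_le_pow_left₀ (heven.pow_nonneg E) hbox 2).trans (hspec.trans (le_trans ?_ hle))
    gcongr
  have h2 := le_of_sq_le_sq h1 (by positivity)
  exact le_of_pow_le_pow_left₀ (by positivity) hB h2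

end InterleavedProduct

/-! ### Numerical constants and conclusion. -/

section Main

open Matrix

variable (F : Type*) [Field F] [Fintype F] [DecidableEq F]

theorem two_le_numSquares (hF : 4 ≤ Fintype.card F) : 2 ≤ numSquares F := by
  have := card_units_le_two_mul_card_image_sq (F := F)
  unfold numSquares
  omega

theorem card_le_numSquares_pow (hF : 4 ≤ Fintype.card F) :
    Fintype.card (SpecialLinearGroup (Fin 2) F) ≤ numSquares F ^ 12 := by
  have h1 : Fintype.card (SpecialLinearGroup (Fin 2) F) ≤ Fintype.card F ^ 4 := by
    refine (Fintype.card_le_of_injective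
      (fun g : SpecialLinearGroup (Fin 2) F => (g : Matrix (Fin 2) (Fin 2) F))
      Subtype.val_injective).trans ?_
    rw [show Fintype.card (Matrix (Fin 2) (Fin 2) F) = (Fintype.card F ^ 2) ^ 2 from
      (Fintype.card_congr Matrix.of.symm).trans (by simp), ← pow_mul]
  have h2 : Fintype.card F - 1 ≤ 2 * numSquares F := card_units_le_two_mul_card_image_sq
  have h3 := two_le_numSquares F hF
  -- With D = `numSquares F` ≥ 2, q ≤ 2D + 1 ≤ 4D ≤ D³.
  have h4 : Fintype.card F ≤ numSquares F ^ 3 := by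
    have : 2 * 2 * numSquares F ≤ numSquares F * numSquares F * numSquares F := by gcongr
    have h5 : numSquares F ^ 3 = numSquares F * numSquares F * numSquares F := by ring
    omega
  calc _ ≤ Fintype.card F ^ 4 := h1
    _ ≤ (numSquares F ^ 3) ^ 4 := Nat.pow_le_pow_left h4 4
    _ = _ := by ring

theorem hasSmallCoefficients_specialLinearGroup (V : Type*) [NormedAddCommGroup V]
    [InnerProductSpace ℂ V] (hF : 0 < numSquares F) :
    HasSmallCoefficients (SpecialLinearGroup (Fin 2) F) V
      ((numSquares F : ℝ) ^ (-(1 / 2 : ℝ))) := by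
  intro ρ W hW hne
  obtain ⟨e, he, he1, hsum⟩ := exists_small_matrix_coefficient ρ W hW hne
  refine ⟨e, he, he1, ?_⟩
  have hD : (0 : ℝ) < numSquares F := by exact_mod_cast hF
  have hx2 : ((numSquares F : ℝ) ^ (-(1 / 2 : ℝ))) ^ 2 = (numSquares F : ℝ)⁻¹ := by
    rw [← Real.rpow_mul_natCast hD.le, ← Real.rpow_neg_one]
    norm_num
  rw [hx2, le_inv_mul_iff₀ hD]
  exact hsum

end Main

theorem theorem1 :
    ∃ c : ℝ, 1 < c ∧
      ∀ (F : Type*) [Field F] [Fintype F] [DecidableEq F], 4 ≤ Fintype.card F →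
      ∀ (k t b : ℕ), 1 ≤ k → c ^ k ≤ (t : ℝ) →
      ∀ P : NOFProtocol (Matrix.SpecialLinearGroup (Fin 2) F) k t, P.bits ≤ b →
      ∀ g h : Matrix.SpecialLinearGroup (Fin 2) F,
        |acceptProb P g - acceptProb P h| ≤
          (2 : ℝ) ^ b *
            (Fintype.card (Matrix.SpecialLinearGroup (Fin 2) F) : ℝ) ^ (-((t : ℝ) / c ^ k)) := by
  -- Each further party costs 8 for the eighth root and 2 for Cauchy–Schwarz, so 16 would do per
  -- party. The base case needs 240 = 24 · 10, where 24 comes from x ≤ |H|^(-1/24).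
  refine ⟨240, by norm_num, ?_⟩
  intro F _ _ _ hF k t b hk ht P hP g h
  obtain ⟨k, rfl⟩ := Nat.exists_eq_succ_of_ne_zero (by omega : k ≠ 0)
  have ht0 : t ≠ 0 := by
    rintro rfl
    have : (0 : ℝ) < 240 ^ k.succ := by positivity
    rw [Nat.cast_zero] at ht
    linarith
  obtain ⟨t, rfl⟩ := Nat.exists_eq_succ_of_ne_zero ht0
  have hD2 := two_le_numSquares F hF
  set D : ℝ := (numSquares F : ℝ) with hD
  set N : ℝ := (Fintype.card (Matrix.SpecialLinearGroup (Fin 2) F) : ℝ) with hN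
  have hD2' : 2 ≤ D := by rw [hD]; exact_mod_cast hD2
  have hN1 : 1 ≤ N := by
    rw [hN]; exact_mod_cast Fintype.card_pos (α := Matrix.SpecialLinearGroup (Fin 2) F)
  have hN0 : 0 < N := by linarith
  have hND : N ≤ D ^ 12 := by rw [hN, hD]; exact_mod_cast card_le_numSquares_pow F hF
  set x : ℝ := D ^ (-(1 / 2 : ℝ)) with hx
  have hx0 : 0 < x := by positivity
  have hx2 : x ^ 2 = D⁻¹ := by
    rw [hx, ← Real.rpow_mul_natCast (by positivity), ← Real.rpow_neg_one]
    norm_num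
  have hx34 : x ≤ 3 / 4 := by
    have : D⁻¹ ≤ 2⁻¹ := inv_anti₀ (by norm_num) hD2'
    nlinarith
  have hxN : x ≤ N ^ (-(1 / 24 : ℝ)) := by
    have h1 : N ^ (1 / 24 : ℝ) ≤ D ^ (1 / 2 : ℝ) := by
      calc N ^ (1 / 24 : ℝ) ≤ (D ^ 12) ^ (1 / 24 : ℝ) := by gcongr
        _ = D ^ (1 / 2 : ℝ) := by
          rw [← Real.rpow_natCast, ← Real.rpow_mul (by positivity)]
          norm_num
    rw [hx, Real.rpow_neg (by positivity), Real.rpow_neg (by positivity)]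
    exact inv_anti₀ (by positivity) h1
  set T : ℝ := ((t.succ : ℕ) : ℝ) with hT
  have hT0 : 0 ≤ T := by positivity
  refine (abs_acceptProb_sub_le (B := N ^ (-(T / 240 ^ k.succ))) hx0 hx34
    (hasSmallCoefficients_specialLinearGroup F _ (by omega)) P g h (by positivity) ?_).trans ?_
  · rw [← hN, ← Real.rpow_mul_natCast hx0.le]
    calc (N ^ 3) ^ 2 ^ (k + 1) * x ^ ((1 / 8 : ℝ) ^ k * ((t + 1 : ℕ) : ℝ))
        ≤ (N ^ 3) ^ 2 ^ (k + 1) * (N ^ (-(1 / 24 : ℝ))) ^ ((1 / 8 : ℝ) ^ k * T) := by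
          gcongr
      _ = N ^ ((3 : ℝ) * 2 ^ (k + 1) + -(1 / 24) * ((1 / 8) ^ k * T)) := by
          rw [Real.rpow_add hN0, Real.rpow_mul hN0.le, Real.rpow_mul hN0.le]
          norm_cast
      _ ≤ N ^ (-(T / 240 ^ k.succ) * 2 ^ (k + 1) * 2) := by
          apply Real.rpow_le_rpow_of_exponent_le hN1
          have h2 : (0 : ℝ) < 2 ^ k := by positivity
          have h8 : (0 : ℝ) < 8 ^ k := by positivity
          have h15 : (1 : ℝ) ≤ 15 ^ k := one_le_pow₀ (by norm_num)
          have h240 : (240 : ℝ) ^ k.succ = 240 * (15 ^ k * (2 ^ k * 8 ^ k)) := by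
            rw [Nat.succ_eq_add_one, pow_succ', ← mul_pow, ← mul_pow]
            norm_num
          -- In terms of `r ≥ 1`, the gain 10 · 15^k · 2^k · r must cover the loss 6 · 2^k from the
          -- norm of `f` and the target 4 · 2^k · r.
          obtain ⟨r, hr⟩ : ∃ r, T = r * 240 ^ k.succ := ⟨T / 240 ^ k.succ, by field_simp⟩
          have hr1 : 1 ≤ r := by
            rw [hr] at ht
            nlinarith [show (0 : ℝ) < 240 ^ k.succ by positivity]
          have h1 : T / 240 ^ k.succ = r := by rw [hr]; field_simp
          have h3 : (1 / 8 : ℝ) ^ k * T = r * (240 * (15 ^ k * 2 ^ k)) := by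
            rw [hr, h240, one_div, inv_pow]; field_simp
          have h4 : 2 ^ k * r ≤ 2 ^ k * r * 15 ^ k := le_mul_of_one_le_right (by positivity) h15
          have h5 : (2 : ℝ) ^ k ≤ 2 ^ k * r := le_mul_of_one_le_right (by positivity) hr1
          rw [h1, h3, pow_succ]
          linarith
      _ = _ := by
          rw [Real.rpow_mul hN0.le, Real.rpow_mul hN0.le]
          norm_cast
  · gcongr
    norm_num
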